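/- **Theorem (Uniqueness).** Let $d\in\{2,3\}$, let $\Omega\subset\mathbb R^d$ be a bounded open set with $0\in\Omega$ such that $\mathbb R^d\setminus\overline\Omega$ is connected, and let $\mathbb M\subset\mathbb R^d\setminus\overline\Omega$ be a non-empty bounded open set. Let $k>0$, let $\mathbf m\in\mathbb R^d$ with $|\mathbf m|<1$, and put $\beta=\sqrt{1-|\mathbf m|^2}$ and $|z|_{\mathbf m}=\sqrt{(z\cdot\mathbf m)^2+\beta^2|z|^2}$. Let $g$ be the free field Green's function of the convected Helmholtz equation $(k+i\,\mathbf m\cdot\nabla)^2p+\Delta p=-Q$, that is, with $z=x-y\neq 0$, $$g(x,y)=\frac{\exp\left(\frac{ik}{\beta^2}\left(-z\cdot\mathbf m+|z|_{\mathbf m}\right)\right)}{4\pi|z|_{\mathbf m}}\quad(d=3),\qquad g(x,y)=\frac{i}{4\beta}\exp\left(-\frac{ik}{\beta^2}\,z\cdot\mathbf m\right)H_0^{(1)}\left(\frac{k}{\beta^2}|z|_{\mathbf m}\right)\quad(d=2),$$ where $H^{(1)}_0=J_0+iY_0$ is the Hankel function of the first kind of order $0$. Let $\mathcal G:L^2(\Omega)\to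 L^2(\mathbb M)$, $(\mathcal Gv)(x)=\int_\Omega g(x,y)v(y)\,dy$, be the volume potential operator between the spaces of complex-valued square integrable functions, and for $q\in L^\infty(\Omega)$ (complex-valued) let $M_q v=qv$ on $L^2(\Omega)$ and let $\mathcal C(q)=\mathcal G M_q\mathcal G^*$, a Hilbert–Schmidt operator on $L^2(\mathbb M)$. If $q_1,q_2\in L^\infty(\Omega)$ satisfy $\mathcal C(q_1)=\mathcal C(q_2)$, then $q_1=q_2$ (almost everywhere in $\Omega$). -/

import Mathlib

open MeasureTheory

set_option linter.unusedSectionVars false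

noncomputable section

section IntegralOperators

variable {X Y : Type*} [MeasurableSpace X] [MeasurableSpace Y] {μ : Measure X} {ν : Measure Y}
  [SFinite μ] [SFinite ν]

theorem ae_memLp_section {κ : X × Y → ℂ} (hκ : MemLp κ 2 (μ.prod ν)) :
    ∀ᵐ x ∂μ, MemLp (fun y => κ (x, y)) 2 ν := by
  have h1 := (memLp_two_iff_integrable_sq_norm hκ.1).1 hκ
  filter_upwards [h1.prod_right_ae, hκ.1.prodMk_left] with x hx hm
  exact (memLp_two_iff_integrable_sq_norm hm).2 hx

theorem integral_mul_eq_inner {k : Y → ℂ} (hk : MemLp k 2 ν) (v : Lp ℂ 2 ν) :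
    ∫ y, k y * v y ∂ν = inner ℂ (hk.star.toLp (star k)) v := by
  rw [L2.inner_def]
  refine integral_congr_ae ?_
  filter_upwards [hk.star.coeFn_toLp] with y hy
  simp [hy, mul_comm]

theorem norm_sq_toLp_star {k : Y → ℂ} (hk : MemLp k 2 ν) :
    ‖hk.star.toLp (star k)‖ ^ 2 = ∫ y, ‖k y‖ ^ 2 ∂ν := by
  have h1 : inner ℂ (hk.star.toLp (star k)) (hk.star.toLp (star k)) =
      ((∫ y, ‖k y‖ ^ 2 ∂ν : ℝ) : ℂ) := by
    rw [← integral_mul_eq_inner hk, ← integral_complex_ofReal]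
    refine integral_congr_ae ?_
    filter_upwards [hk.star.coeFn_toLp] with y hy
    simp [hy, Complex.mul_conj, Complex.normSq_eq_norm_sq]
  rw [inner_self_eq_norm_sq_to_K, ← RCLike.ofReal_pow] at h1
  exact Complex.ofReal_injective h1

theorem norm_sq_integral_mul_le {k : Y → ℂ} (hk : MemLp k 2 ν) (v : Lp ℂ 2 ν) :
    ‖∫ y, k y * v y ∂ν‖ ^ 2 ≤ (∫ y, ‖k y‖ ^ 2 ∂ν) * ‖v‖ ^ 2 := by
  rw [integral_mul_eq_inner hk, ← norm_sq_toLp_star hk, ← mul_pow]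
  gcongr
  exact norm_inner_le_norm _ _

theorem integrable_section_sq {κ : X × Y → ℂ} (hκ : MemLp κ 2 (μ.prod ν)) :
    Integrable (fun x => ∫ y, ‖κ (x, y)‖ ^ 2 ∂ν) μ :=
  ((memLp_two_iff_integrable_sq_norm hκ.1).1 hκ).integral_prod_left

theorem memLp_integral_mul {κ : X × Y → ℂ} (hκ : MemLp κ 2 (μ.prod ν)) (v : Lp ℂ 2 ν) :
    MemLp (fun x => ∫ y, κ (x, y) * v y ∂ν) 2 μ := by
  have hm : AEStronglyMeasurable (fun x => ∫ y, κ (x, y) * v y ∂ν) μ :=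
    (hκ.1.mul (Lp.aestronglyMeasurable v).comp_snd).integral_prod_right'
  rw [memLp_two_iff_integrable_sq_norm hm]
  refine ((integrable_section_sq hκ).mul_const (‖v‖ ^ 2)).mono' (hm.norm.pow 2) ?_
  filter_upwards [ae_memLp_section hκ] with x hx
  simpa using norm_sq_integral_mul_le hx v

theorem norm_sq_toLp {f : X → ℂ} (hf : MemLp f 2 μ) :
    ‖hf.toLp f‖ ^ 2 = ∫ x, ‖f x‖ ^ 2 ∂μ := by
  have h := norm_sq_toLp_star hf.star
  simpa using h

/-- The integral operator `v ↦ (x ↦ ∫ κ (x, y) v(y) dν(y))` from `L²(ν)` to `L²(μ)` with a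
square integrable kernel `κ`. -/
def integralOperator (κ : X × Y → ℂ) (hκ : MemLp κ 2 (μ.prod ν)) :
    Lp ℂ 2 ν →L[ℂ] Lp ℂ 2 μ :=
  LinearMap.mkContinuous
    { toFun := fun v => (memLp_integral_mul hκ v).toLp (fun x => ∫ y, κ (x, y) * v y ∂ν)
      map_add' := by
        intro v w
        rw [← MemLp.toLp_add]
        refine MemLp.toLp_congr _ _ ?_
        filter_upwards [ae_memLp_section hκ] with x hx
        simp only [Pi.add_apply, integral_mul_eq_inner hx, inner_add_right]
      map_smul' := by
        intro c v
        rw [RingHom.id_apply, ← MemLp.toLp_const_smul]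
        refine MemLp.toLp_congr _ _ ?_
        filter_upwards [ae_memLp_section hκ] with x hx
        simp only [Pi.smul_apply, integral_mul_eq_inner hx, inner_smul_right, smul_eq_mul] }
    (Real.sqrt (∫ x, ∫ y, ‖κ (x, y)‖ ^ 2 ∂ν ∂μ))
    (by
      intro v
      refine abs_le_of_sq_le_sq' ?_ (by positivity) |>.2
      rw [mul_pow, Real.sq_sqrt (by positivity), ← integral_mul_const]
      refine (norm_sq_toLp (memLp_integral_mul hκ v)).trans_le ?_
      refine integral_mono_ae
        ((memLp_two_iff_integrable_sq_norm (memLp_integral_mul hκ v).1).1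
          (memLp_integral_mul hκ v)) ((integrable_section_sq hκ).mul_const _) ?_
      filter_upwards [ae_memLp_section hκ] with x hx
      exact norm_sq_integral_mul_le hx v)

theorem summable_norm_sq_integralOperator {κ : X × Y → ℂ} (hκ : MemLp κ 2 (μ.prod ν))
    {ι : Type*} {e : ι → Lp ℂ 2 ν} (he : Orthonormal ℂ e) :
    Summable fun i => ‖integralOperator κ hκ (e i)‖ ^ 2 := by
  refine summable_of_sum_le (c := ∫ x, ∫ y, ‖κ (x, y)‖ ^ 2 ∂ν ∂μ) (fun i => by positivity) ?_
  intro u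
  have h1 : ∀ i, ‖integralOperator κ hκ (e i)‖ ^ 2 = ∫ x, ‖∫ y, κ (x, y) * e i y ∂ν‖ ^ 2 ∂μ :=
    fun i => norm_sq_toLp (memLp_integral_mul hκ (e i))
  have h2 : ∀ i, Integrable (fun x => ‖∫ y, κ (x, y) * e i y ∂ν‖ ^ 2) μ := fun i =>
    (memLp_two_iff_integrable_sq_norm (memLp_integral_mul hκ (e i)).1).1
      (memLp_integral_mul hκ (e i))
  simp only [h1]
  rw [← integral_finsetSum _ (fun i _ => h2 i)]
  refine integral_mono_ae (integrable_finsetSum _ fun i _ => h2 i) (integrable_section_sq hκ) ?_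
  filter_upwards [ae_memLp_section hκ] with x hx
  simp only [integral_mul_eq_inner hx, ← norm_sq_toLp_star hx]
  simpa only [norm_inner_symm] using he.sum_inner_products_le (hx.star.toLp _) (s := u)

end IntegralOperators

section HilbertSchmidt

variable {H K L : Type*} [NormedAddCommGroup H] [InnerProductSpace ℂ H] [CompleteSpace H]
  [NormedAddCommGroup K] [InnerProductSpace ℂ K] [CompleteSpace K]
  [NormedAddCommGroup L] [InnerProductSpace ℂ L]

/-- Hilbert–Schmidt operators: `∑ ‖T eᵢ‖² = tr (T* T)` is finite for every orthonormal (Hilbert)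
basis of `H`; equivalently `T` is compact and the eigenvalues of `T* T` are summable. -/
def IsHilbertSchmidt (T : H →L[ℂ] L) : Prop :=
  ∀ (s : Set H) (b : HilbertBasis s ℂ H), Summable fun i => ‖T (b i)‖ ^ 2

theorem IsHilbertSchmidt.adjoint {T : H →L[ℂ] K} (hT : IsHilbertSchmidt T) :
    IsHilbertSchmidt (ContinuousLinearMap.adjoint T) := by
  intro s b
  obtain ⟨w, f, -⟩ := exists_hilbertBasis ℂ H
  have hTf := hT w f
  have key : ∀ x : H, HasSum (fun j => ‖inner ℂ (f j) x‖ ^ 2) (‖x‖ ^ 2) := by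
    intro x
    have h := f.hasSum_inner_mul_inner x x
    rw [inner_self_eq_norm_sq_to_K, ← RCLike.ofReal_pow] at h
    have h2 : ∀ j, inner ℂ x (f j) * inner ℂ (f j) x = ((‖inner ℂ (f j) x‖ ^ 2 : ℝ) : ℂ) := by
      intro j
      rw [← inner_conj_symm x (f j), Complex.conj_mul']
      simp
    simp only [h2] at h
    exact Complex.hasSum_ofReal.1 h
  refine summable_of_sum_le (c := ∑' j, ‖T (f j)‖ ^ 2) (fun i => by positivity) ?_
  intro u
  have h3 := hasSum_sum (s := u) (fun i _ => key (ContinuousLinearMap.adjoint T (b i)))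
  rw [← h3.tsum_eq]
  refine h3.summable.tsum_le_tsum ?_ hTf
  intro j
  simp only [ContinuousLinearMap.adjoint_inner_right]
  simpa only [norm_inner_symm] using b.orthonormal.sum_inner_products_le (T (f j)) (s := u)

theorem IsHilbertSchmidt.comp_left {T : H →L[ℂ] K} (hT : IsHilbertSchmidt T) (B : K →L[ℂ] L) :
    IsHilbertSchmidt (B ∘L T) := by
  intro s b
  refine Summable.of_nonneg_of_le (fun i => by positivity) (fun i => ?_)
    ((hT s b).mul_left (‖B‖ ^ 2))
  rw [← mul_pow]
  gcongr
  exact B.le_opNorm _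

variable (H) in
/-- The Hilbert–Schmidt operators on `H`. -/
def HilbertSchmidt : Type _ := {T : H →L[ℂ] H // IsHilbertSchmidt T}

end HilbertSchmidt
section Bessel

/-- The Bessel function `J₀`. -/
def besselJ0 (t : ℝ) : ℝ :=
  ∑' n : ℕ, (-1) ^ n / (n.factorial : ℝ) ^ 2 * (t / 2) ^ (2 * n)

/-- The Neumann function `Y₀` (Bessel function of the second kind) on the positive half-line. -/
def besselY0 (t : ℝ) : ℝ :=
  2 / Real.pi * (Real.log (t / 2) + Real.eulerMascheroniConstant) * besselJ0 t -
    2 / Real.pi *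
      ∑' n : ℕ, (-1) ^ n * (harmonic n : ℝ) / (n.factorial : ℝ) ^ 2 * (t / 2) ^ (2 * n)

/-- The Hankel function of the first kind of order zero, `H₀⁽¹⁾ = J₀ + i Y₀`, for positive
arguments. -/
def hankelH0 (t : ℝ) : ℂ := (besselJ0 t : ℂ) + Complex.I * (besselY0 t : ℂ)

theorem evenSeries_bound {a : ℕ → ℝ} (ha : ∀ n, |a n| ≤ 1 / (n.factorial : ℝ)) (t : ℝ) :
    Summable (fun n => a n * (t / 2) ^ (2 * n)) ∧
      |∑' n, a n * (t / 2) ^ (2 * n)| ≤ Real.exp (t ^ 2 / 4) := by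
  have hexp : HasSum (fun n : ℕ => (t ^ 2 / 4) ^ n / (n.factorial : ℝ)) (Real.exp (t ^ 2 / 4)) := by
    rw [Real.exp_eq_exp_ℝ]
    exact NormedSpace.expSeries_div_hasSum_exp (t ^ 2 / 4)
  have hle : ∀ n, ‖a n * (t / 2) ^ (2 * n)‖ ≤ (t ^ 2 / 4) ^ n / (n.factorial : ℝ) := by
    intro n
    have h : (t / 2) ^ (2 * n) = (t ^ 2 / 4) ^ n := by rw [pow_mul]; congr 1; ring
    rw [norm_mul, h, Real.norm_of_nonneg (by positivity : (0 : ℝ) ≤ (t ^ 2 / 4) ^ n),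
      Real.norm_eq_abs]
    calc |a n| * (t ^ 2 / 4) ^ n ≤ 1 / (n.factorial : ℝ) * (t ^ 2 / 4) ^ n := by
          gcongr
          exact ha n
      _ = _ := by ring
  exact ⟨Summable.of_norm_bounded hexp.summable hle, tsum_of_norm_bounded hexp hle⟩

theorem measurable_evenSeries {a : ℕ → ℝ} (ha : ∀ n, |a n| ≤ 1 / (n.factorial : ℝ)) :
    Measurable fun t : ℝ => ∑' n, a n * (t / 2) ^ (2 * n) := by
  refine measurable_of_tendsto_metrizable
    (f := fun N t => ∑ n ∈ Finset.range N, a n * (t / 2) ^ (2 * n)) (fun N => by fun_prop) ?_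
  rw [tendsto_pi_nhds]
  exact fun t => (evenSeries_bound ha t).1.hasSum.tendsto_sum_nat

theorem coeffJ_bound (n : ℕ) : |(-1) ^ n / (n.factorial : ℝ) ^ 2| ≤ 1 / (n.factorial : ℝ) := by
  have h : (1 : ℝ) ≤ n.factorial := by exact_mod_cast n.factorial_pos
  rw [abs_div, abs_pow, abs_neg, abs_one, one_pow, abs_of_pos (by positivity)]
  gcongr
  nlinarith

theorem harmonic_le_factorial (n : ℕ) : (harmonic n : ℝ) ≤ n.factorial := by
  have h : harmonic n ≤ (n : ℚ) := by
    unfold harmonic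
    calc _ ≤ ∑ i ∈ Finset.range n, (1 : ℚ) := Finset.sum_le_sum fun i _ =>
          inv_le_one_of_one_le₀ (by push_cast; linarith [(Nat.cast_nonneg i : (0 : ℚ) ≤ i)])
      _ = n := by simp
  calc (harmonic n : ℝ) ≤ n := by exact_mod_cast h
    _ ≤ n.factorial := by exact_mod_cast n.self_le_factorial

theorem coeffY_bound (n : ℕ) :
    |(-1) ^ n * (harmonic n : ℝ) / (n.factorial : ℝ) ^ 2| ≤ 1 / (n.factorial : ℝ) := by
  have h0 : (0 : ℝ) < n.factorial := by exact_mod_cast n.factorial_pos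
  have h1 : (0 : ℝ) ≤ harmonic n := by
    unfold harmonic
    push_cast
    exact Finset.sum_nonneg fun i _ => by positivity
  rw [abs_div, abs_mul, abs_pow, abs_neg, abs_one, one_pow, one_mul, abs_of_nonneg h1,
    abs_of_pos (by positivity), div_le_div_iff₀ (by positivity) h0]
  nlinarith [harmonic_le_factorial n]

theorem measurable_hankelH0 : Measurable hankelH0 := by
  have h1 : Measurable besselJ0 := measurable_evenSeries coeffJ_bound
  have h2 := measurable_evenSeries coeffY_bound
  have h3 : Measurable besselY0 := by
    unfold besselY0
    exact ((((Real.measurable_log.comp (measurable_id.div_const 2)).add_const _).const_mul _).mul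
      h1).sub (h2.const_mul _)
  exact (Complex.measurable_ofReal.comp h1).add
    ((Complex.measurable_ofReal.comp h3).const_mul _)

theorem abs_log_le_add {u : ℝ} (hu : 0 < u) : |Real.log u| ≤ u + 2 / Real.sqrt u := by
  have hs : 0 < Real.sqrt u := Real.sqrt_pos.2 hu
  have h1 : Real.log u ≤ u := by linarith [Real.log_le_sub_one_of_pos hu]
  have h2 : -Real.log u ≤ 2 / Real.sqrt u := by
    have h := Real.log_le_sub_one_of_pos (inv_pos.2 hs)
    rw [Real.log_inv, Real.log_sqrt hu.le] at h
    rw [div_eq_mul_inv]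
    linarith
  rw [abs_le]
  constructor
  · linarith
  · have : 0 < 2 / Real.sqrt u := by positivity
    linarith

theorem exists_hankelH0_bound (T : ℝ) :
    ∃ C : ℝ, ∀ t : ℝ, 0 < t → t ≤ T → ‖hankelH0 t‖ ^ 2 ≤ C / t := by
  refine ⟨(Real.exp (T ^ 2 / 4) * ((3 + T) * Real.sqrt T + 2 * Real.sqrt 2)) ^ 2, ?_⟩
  intro t ht htT
  have hst : 0 < Real.sqrt t := Real.sqrt_pos.2 ht
  set E := Real.exp (T ^ 2 / 4) with hE
  have hE0 : 0 < E := Real.exp_pos _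
  have hexp : Real.exp (t ^ 2 / 4) ≤ E := by
    apply Real.exp_le_exp.2
    gcongr
  have hJ : |besselJ0 t| ≤ E := (evenSeries_bound coeffJ_bound t).2.trans hexp
  have hS := (evenSeries_bound coeffY_bound t).2.trans hexp
  have hpi : 2 / Real.pi ≤ 1 := by
    rw [div_le_one Real.pi_pos]
    linarith [Real.pi_gt_three]
  have hpi0 : 0 < 2 / Real.pi := by positivity
  have hγ : |Real.eulerMascheroniConstant| ≤ 1 := by
    rw [abs_le]
    constructor <;> linarith [Real.one_half_lt_eulerMascheroniConstant,
      Real.eulerMascheroniConstant_lt_two_thirds]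
  have hlog : |Real.log (t / 2) + Real.eulerMascheroniConstant| ≤
      T + 2 / Real.sqrt (t / 2) + 1 := by
    have h := abs_log_le_add (half_pos ht)
    refine (abs_add_le _ _).trans ?_
    linarith
  have hY : |besselY0 t| ≤ (T + 2 / Real.sqrt (t / 2) + 1) * E + E := by
    unfold besselY0
    refine (abs_sub _ _).trans ?_
    rw [abs_mul, abs_mul, abs_mul (2 / Real.pi), abs_of_pos hpi0]
    have h0 : 0 ≤ T + 2 / Real.sqrt (t / 2) + 1 := (abs_nonneg _).trans hlog
    have h1 := mul_le_mul (mul_le_mul hpi hlog (abs_nonneg _) zero_le_one) hJ (abs_nonneg _)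
      (by linarith)
    have h2 := mul_le_mul hpi hS (abs_nonneg _) zero_le_one
    linarith
  have hH : ‖hankelH0 t‖ ≤ E * (3 + T + 2 / Real.sqrt (t / 2)) := by
    unfold hankelH0
    refine (norm_add_le _ _).trans ?_
    rw [norm_mul, Complex.norm_I, one_mul, Complex.norm_real, Complex.norm_real, Real.norm_eq_abs,
      Real.norm_eq_abs]
    linarith
  have hT : Real.sqrt t ≤ Real.sqrt T := Real.sqrt_le_sqrt htT
  have hmul : ‖hankelH0 t‖ * Real.sqrt t ≤ E * ((3 + T) * Real.sqrt T + 2 * Real.sqrt 2) := by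
    have h1 : (3 + T + 2 / Real.sqrt (t / 2)) * Real.sqrt t =
        (3 + T) * Real.sqrt t + 2 * Real.sqrt 2 := by
      rw [Real.sqrt_div ht.le]
      field_simp
    calc _ ≤ E * (3 + T + 2 / Real.sqrt (t / 2)) * Real.sqrt t := by gcongr
      _ = E * ((3 + T) * Real.sqrt t + 2 * Real.sqrt 2) := by rw [mul_assoc, h1]
      _ ≤ _ := by gcongr; linarith
  rw [le_div_iff₀ ht]
  calc ‖hankelH0 t‖ ^ 2 * t = (‖hankelH0 t‖ * Real.sqrt t) ^ 2 := by
        rw [mul_pow, Real.sq_sqrt ht.le]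
    _ ≤ _ := by gcongr

end Bessel

section Green

open Bornology

variable {d : ℕ}

/-- `β² = 1 - |m|²`. -/
def betaSq (m : EuclideanSpace ℝ (Fin d)) : ℝ := 1 - ‖m‖ ^ 2

/-- The Mach scaled norm `|z|ₘ = √((z · m)² + β² |z|²)`. -/
def machNorm (m z : EuclideanSpace ℝ (Fin d)) : ℝ :=
  Real.sqrt ((inner ℝ z m) ^ 2 + betaSq m * ‖z‖ ^ 2)

/-- The free field Green's function `g(x, y)` of the convected Helmholtz equation
`(k + i m · ∇)² p + Δ p = -Q` with wave number `k` and Mach vector `m`, as a function of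
`z = x - y`, in dimension `d = 3` and (the other branch) in dimension `d = 2`. -/
def greenKernel (k : ℝ) (m z : EuclideanSpace ℝ (Fin d)) : ℂ :=
  if d = 3 then
    Complex.exp (Complex.I * ((k / betaSq m * (-(inner ℝ z m) + machNorm m z) : ℝ) : ℂ)) /
      ((4 * Real.pi * machNorm m z : ℝ) : ℂ)
  else
    Complex.I / ((4 * Real.sqrt (betaSq m) : ℝ) : ℂ) *
      Complex.exp (-(Complex.I * ((k / betaSq m * inner ℝ z m : ℝ) : ℂ))) *
      hankelH0 (k / betaSq m * machNorm m z)

theorem measurable_machNorm (m : EuclideanSpace ℝ (Fin d)) : Measurable (machNorm m) := by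
  unfold machNorm
  have : Continuous fun z : EuclideanSpace ℝ (Fin d) =>
      Real.sqrt ((inner ℝ z m) ^ 2 + betaSq m * ‖z‖ ^ 2) := by fun_prop
  exact this.measurable

theorem measurable_greenKernel (k : ℝ) (m : EuclideanSpace ℝ (Fin d)) :
    Measurable (greenKernel k m) := by
  have hN := measurable_machNorm m
  have hI : Measurable fun z : EuclideanSpace ℝ (Fin d) => (inner ℝ z m : ℝ) :=
    (by fun_prop : Continuous fun z : EuclideanSpace ℝ (Fin d) => (inner ℝ z m : ℝ)).measurable
  have hH : Measurable fun z => hankelH0 (k / betaSq m * machNorm m z) :=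
    measurable_hankelH0.comp (hN.const_mul _)
  unfold greenKernel
  split_ifs
  · fun_prop
  · fun_prop

theorem betaSq_pos {m : EuclideanSpace ℝ (Fin d)} (hm : ‖m‖ < 1) : 0 < betaSq m := by
  unfold betaSq
  nlinarith [norm_nonneg m]

theorem le_machNorm {m : EuclideanSpace ℝ (Fin d)} (z : EuclideanSpace ℝ (Fin d)) :
    Real.sqrt (betaSq m) * ‖z‖ ≤ machNorm m z := by
  unfold machNorm
  rw [← Real.sqrt_sq (norm_nonneg z), ← Real.sqrt_mul' _ (sq_nonneg _),
    Real.sqrt_sq (norm_nonneg z)]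
  exact Real.sqrt_le_sqrt (by nlinarith [sq_nonneg (inner ℝ z m)])

theorem machNorm_le {m : EuclideanSpace ℝ (Fin d)} (z : EuclideanSpace ℝ (Fin d)) :
    machNorm m z ≤ ‖z‖ := by
  unfold machNorm betaSq
  refine Real.sqrt_le_iff.2 ⟨norm_nonneg z, ?_⟩
  have h := abs_real_inner_le_norm z m
  have h2 : (inner ℝ z m) ^ 2 ≤ (‖z‖ * ‖m‖) ^ 2 := sq_le_sq' (abs_le.1 h).1 (abs_le.1 h).2
  nlinarith

theorem greenKernel_bound (hd : d = 2 ∨ d = 3) {k : ℝ} (hk : 0 < k)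
    {m : EuclideanSpace ℝ (Fin d)} (hm : ‖m‖ < 1) (R : ℝ) :
    ∃ C : ℝ, ∃ α : ℝ, α < d ∧ ∀ z : EuclideanSpace ℝ (Fin d), z ≠ 0 → ‖z‖ ≤ R →
      ‖greenKernel k m z‖ ^ 2 ≤ C * ‖z‖ ^ (-α) := by
  have hb := betaSq_pos hm
  have hsb := Real.sqrt_pos.2 hb
  rcases hd with rfl | rfl
  · obtain ⟨C, hC⟩ := exists_hankelH0_bound (k / betaSq m * R)
    refine ⟨(1 / (4 * Real.sqrt (betaSq m))) ^ 2 *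
      (|C| / (k / betaSq m * Real.sqrt (betaSq m))), 1, by norm_num, ?_⟩
    intro z hz hzR
    have hz0 : 0 < ‖z‖ := norm_pos_iff.2 hz
    have hN : 0 < machNorm m z := (mul_pos hsb hz0).trans_le (le_machNorm z)
    have hH := hC (k / betaSq m * machNorm m z) (by positivity) (by
      gcongr
      exact (machNorm_le z).trans hzR)
    have hH2 : ‖hankelH0 (k / betaSq m * machNorm m z)‖ ^ 2 ≤
        |C| / (k / betaSq m * Real.sqrt (betaSq m)) * ‖z‖ ^ (-1 : ℝ) := by
      rw [Real.rpow_neg_one, ← div_eq_mul_inv, div_div, mul_assoc (k / betaSq m)]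
      refine hH.trans ?_
      gcongr
      · exact le_abs_self C
      · exact le_machNorm z
    have hexp : ‖Complex.exp (-(Complex.I * ((k / betaSq m * inner ℝ z m : ℝ) : ℂ)))‖ = 1 := by
      rw [Complex.norm_exp]
      simp
    have hnorm : ‖Complex.I / ((4 * Real.sqrt (betaSq m) : ℝ) : ℂ)‖ =
        1 / (4 * Real.sqrt (betaSq m)) := by
      rw [norm_div, Complex.norm_I, Complex.norm_real, Real.norm_of_nonneg (by positivity)]
    rw [greenKernel, if_neg (by norm_num), norm_mul, norm_mul, hexp, hnorm, mul_one, mul_pow,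
      mul_assoc]
    gcongr
  · refine ⟨(1 / (4 * Real.pi * Real.sqrt (betaSq m))) ^ 2, 2, by norm_num, ?_⟩
    intro z hz _
    have hz0 : 0 < ‖z‖ := norm_pos_iff.2 hz
    have hN : 0 < machNorm m z := (mul_pos hsb hz0).trans_le (le_machNorm z)
    have hexp : ‖Complex.exp
        (Complex.I * ((k / betaSq m * (-(inner ℝ z m) + machNorm m z) : ℝ) : ℂ))‖ = 1 := by
      rw [Complex.norm_exp]
      simp
    rw [greenKernel, if_pos rfl, norm_div, hexp, Complex.norm_real,
      Real.norm_of_nonneg (by positivity), Real.rpow_neg hz0.le, Real.rpow_two, ← inv_pow,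
      ← mul_pow]
    have h : 1 / (4 * Real.pi * machNorm m z) ≤
        1 / (4 * Real.pi * Real.sqrt (betaSq m)) * ‖z‖⁻¹ := by
      rw [← div_eq_mul_inv, div_div, mul_assoc (4 * Real.pi)]
      gcongr
      exact le_machNorm z
    gcongr

theorem memLp_greenKernel (hd : d = 2 ∨ d = 3) {k : ℝ} (hk : 0 < k)
    {m : EuclideanSpace ℝ (Fin d)} (hm : ‖m‖ < 1) {Ω M : Set (EuclideanSpace ℝ (Fin d))}
    (hΩ : IsBounded Ω) (hM : IsBounded M) (hMm : MeasurableSet M) (hΩm : MeasurableSet Ω) :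
    MemLp (fun p : EuclideanSpace ℝ (Fin d) × EuclideanSpace ℝ (Fin d) =>
      greenKernel k m (p.1 - p.2)) 2 ((volume.restrict M).prod (volume.restrict Ω)) := by
  have hmeas := measurable_greenKernel k m
  have hmeas2 : Measurable fun p : EuclideanSpace ℝ (Fin d) × EuclideanSpace ℝ (Fin d) =>
      greenKernel k m (p.1 - p.2) := hmeas.comp (measurable_fst.sub measurable_snd)
  obtain ⟨r₁, hr₁⟩ := hΩ.exists_norm_le
  obtain ⟨r₂, hr₂⟩ := hM.exists_norm_le
  set R := r₁ + r₂ + 1 with hR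
  obtain ⟨C, α, hα, hC⟩ := greenKernel_bound hd hk hm R
  have hfin : Module.finrank ℝ (EuclideanSpace ℝ (Fin d)) = d := by simp
  have hd1 : 1 ≤ d := by omega
  have : Nontrivial (EuclideanSpace ℝ (Fin d)) :=
    Module.nontrivial_of_finrank_pos (R := ℝ) (by omega)
  have hball : IntegrableOn (fun z => ‖greenKernel k m z‖ ^ 2) (Metric.ball 0 R) := by
    refine integrableOn_ball_of_norm_le_rpow (by omega) (α := α) (C := C) (by rw [hfin]; exact hα)
      ?_ (hmeas.norm.pow_const 2).aestronglyMeasurable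
    filter_upwards [ae_restrict_mem measurableSet_ball,
      ae_restrict_of_ae (Measure.ae_ne volume (0 : EuclideanSpace ℝ (Fin d)))] with z hz hz0
    rw [Real.norm_of_nonneg (by positivity)]
    exact hC z hz0 (mem_ball_zero_iff.1 hz).le
  set F : EuclideanSpace ℝ (Fin d) → ENNReal :=
    (Metric.ball 0 R).indicator fun z => ENNReal.ofReal (‖greenKernel k m z‖ ^ 2) with hF
  have hFint : ∫⁻ z, F z < ⊤ := by
    rw [hF, lintegral_indicator measurableSet_ball]
    have h := hball.2
    rw [hasFiniteIntegral_iff_ofReal (Filter.Eventually.of_forall fun z => by positivity)] at h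
    exact h
  rw [memLp_two_iff_integrable_sq_norm hmeas2.aestronglyMeasurable]
  refine ⟨(hmeas2.norm.pow_const 2).aestronglyMeasurable, ?_⟩
  rw [hasFiniteIntegral_iff_ofReal (Filter.Eventually.of_forall fun z => by positivity),
    lintegral_prod _ ((hmeas2.norm.pow_const 2).ennreal_ofReal.aemeasurable)]
  have hMfin : volume M < ⊤ := hM.measure_lt_top
  refine lt_of_le_of_lt ?_ (ENNReal.mul_lt_top hFint hMfin)
  calc _ ≤ ∫⁻ _ in M, (∫⁻ z, F z) := ?_
    _ = (∫⁻ z, F z) * volume M := by rw [setLIntegral_const]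
  refine setLIntegral_mono' hMm fun x hx => ?_
  calc _ ≤ ∫⁻ y in Ω, F (x - y) := ?_
    _ ≤ ∫⁻ y, F (x - y) := setLIntegral_le_lintegral _ _
    _ = ∫⁻ z, F z := lintegral_sub_left_eq_self F x
  refine setLIntegral_mono' hΩm fun y hy => ?_
  have hxy : x - y ∈ Metric.ball (0 : EuclideanSpace ℝ (Fin d)) R := by
    rw [mem_ball_zero_iff]
    linarith [norm_sub_le x y, hr₁ y hy, hr₂ x hx]
  simp only [hF, Set.indicator_of_mem hxy, le_refl]

end Green

section ForwardOperator

/-- The geometrical and physical setup: a source region `Ω` and a measurement region `M` in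
`ℝᵈ`, `d ∈ {2, 3}`, a wave number `k > 0` and the Mach vector `m` of a constant subsonic flow. -/
structure AcousticSetup (d : ℕ) where
  dim_eq : d = 2 ∨ d = 3
  k : ℝ
  k_pos : 0 < k
  m : EuclideanSpace ℝ (Fin d)
  subsonic : ‖m‖ < 1
  Ω : Set (EuclideanSpace ℝ (Fin d))
  isOpen_Ω : IsOpen Ω
  isBounded_Ω : Bornology.IsBounded Ω
  zero_mem_Ω : 0 ∈ Ω
  isConnected_compl : IsConnected (closure Ω)ᶜ
  M : Set (EuclideanSpace ℝ (Fin d))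
  isOpen_M : IsOpen M
  isBounded_M : Bornology.IsBounded M
  nonempty_M : M.Nonempty
  M_subset : M ⊆ (closure Ω)ᶜ

namespace AcousticSetup

variable {d : ℕ} (S : AcousticSetup d)

/-- The free field Green's function `g(x, y)`. -/
def green (x y : EuclideanSpace ℝ (Fin d)) : ℂ := greenKernel S.k S.m (x - y)

theorem memLp_green :
    MemLp (fun p : EuclideanSpace ℝ (Fin d) × EuclideanSpace ℝ (Fin d) => S.green p.1 p.2) 2
      ((volume.restrict S.M).prod (volume.restrict S.Ω)) :=
  memLp_greenKernel S.dim_eq S.k_pos S.subsonic S.isBounded_Ω S.isBounded_M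
    S.isOpen_M.measurableSet S.isOpen_Ω.measurableSet

/-- The volume potential operator `(G v)(x) = ∫_Ω g(x, y) v(y) dy` from `L²(Ω)` to `L²(M)`. -/
def volumePotential : Lp ℂ 2 (volume.restrict S.Ω) →L[ℂ] Lp ℂ 2 (volume.restrict S.M) :=
  integralOperator (fun p => S.green p.1 p.2) S.memLp_green

/-- The multiplication operator `M_q v = q v` on `L²(Ω)`, for `q ∈ L^∞(Ω)`. -/
def mulOperator (q : Lp ℂ ⊤ (volume.restrict S.Ω)) :
    Lp ℂ 2 (volume.restrict S.Ω) →L[ℂ] Lp ℂ 2 (volume.restrict S.Ω) :=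
  (ContinuousLinearMap.mul ℂ ℂ).holderL (volume.restrict S.Ω) ⊤ 2 2 q

theorem isHilbertSchmidt_forward (q : Lp ℂ ⊤ (volume.restrict S.Ω)) :
    IsHilbertSchmidt (S.volumePotential ∘L S.mulOperator q ∘L
      ContinuousLinearMap.adjoint S.volumePotential) := by
  have h : IsHilbertSchmidt S.volumePotential := fun s b =>
    summable_norm_sq_integralOperator S.memLp_green b.orthonormal
  exact (h.adjoint.comp_left (S.mulOperator q)).comp_left S.volumePotential

/-- The forward operator `C(q) = G M_q G*`, with values in the Hilbert–Schmidt operators on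
`L²(M)`. -/
def forwardOperator (q : Lp ℂ ⊤ (volume.restrict S.Ω)) :
    HilbertSchmidt (Lp ℂ 2 (volume.restrict S.M)) :=
  ⟨S.volumePotential ∘L S.mulOperator q ∘L ContinuousLinearMap.adjoint S.volumePotential,
    S.isHilbertSchmidt_forward q⟩

end AcousticSetup

end ForwardOperator

end

/-! By linearity it suffices to show that $\mathcal G M_q\mathcal G^*=0$ forces $q=0$. Call $f$ an
annihilator if $\int_\Omega f v=0$ for every $v\in\ker\mathcal G$. The range of $M_q\mathcal G^*$
lies in $\ker\mathcal G$, so an annihilator $f$ satisfies $\int fq\,\mathcal G^*\varphi=0$ for all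
$\varphi$. Thus $\overline{fq}$ is orthogonal to the range of $\mathcal G^*$, that is,
$\overline{fq}\in\ker\mathcal G$. A second annihilator $g$ then gives $\int g\,\overline{f q}=0$:
the conjugate of $q$ is orthogonal to all products $g\bar f$ (`integral_mul_star_eq_zero`).

Enough annihilators come from the far field. If $\mathcal Gv=0$ on $\mathbb M$, the potential of $v$
is real analytic along lines off $\overline\Omega$, hence vanishes on the whole connected exterior.
Letting $x\to\infty$ in the direction $\omega$ with $|\omega|_{\mathbf m}=1$ shows that $v$ is
orthogonal to a plane wave (`exists_integral_planeWave_eq_zero`). In $g\bar f$ for the plane waves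
of $\omega'$ and $\omega$ the factors due to the flow cancel, and a pure exponential in
$\omega-\omega'$ remains. As $d\ge2$, such differences fill the ball of radius 2 of the Mach form,
so the Fourier transform of $q$, extended by zero, vanishes near the origin. It is analytic because
$\Omega$ is bounded, hence it vanishes identically, and $q=0$.

Both dimensions are treated together: up to a constant and a flow factor the kernel is
$\Psi(\kappa^2|z|_{\mathbf m}^2)$ with $\kappa=k/\beta^2$, where $\Psi$ is holomorphic on the right
half-plane and $r^p\Psi(r^2)\approx ae^{ir}+be^{-ir}$ with $(a,b)\neq(0,0)$. The values of $a$ and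
$b$ are never needed, so for $H_0^{(1)}$ this weak form of the asymptotics is derived from the
Bessel equation instead of the sharp expansion. -/

noncomputable section

open Filter Topology

/-! ### Power series with coefficients bounded by $1/n!$, over $\mathbb R$ and $\mathbb C$ -/

section EntireSeries

variable {𝕜 : Type*} [RCLike 𝕜]

/-- The coefficients of the derivative of `∑ aₙ zⁿ`. -/
def derivCoeff (a : ℕ → 𝕜) (n : ℕ) : 𝕜 := ((n : 𝕜) + 1) * a (n + 1)

/-- The bound $1/n!$ is stable under differentiation, so one differentiation lemma applies to a
series and to all its derivatives. -/
theorem norm_derivCoeff_le {a : ℕ → 𝕜} (ha : ∀ n, ‖a n‖ ≤ 1 / (n.factorial : ℝ)) (n : ℕ) :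
    ‖derivCoeff a n‖ ≤ 1 / (n.factorial : ℝ) := by
  have h1 : ‖((n : 𝕜) + 1)‖ = (n : ℝ) + 1 := by
    rw [← Nat.cast_succ, RCLike.norm_natCast, Nat.cast_succ]
  have h0 : (0 : ℝ) < n.factorial := by exact_mod_cast n.factorial_pos
  rw [derivCoeff, norm_mul, h1]
  calc ((n : ℝ) + 1) * ‖a (n + 1)‖ ≤ ((n : ℝ) + 1) * (1 / ((n + 1).factorial : ℝ)) := by
        gcongr
        exact ha _
    _ = 1 / (n.factorial : ℝ) := by
        rw [Nat.factorial_succ]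
        push_cast
        field_simp

theorem norm_term_le {a : ℕ → 𝕜} (ha : ∀ n, ‖a n‖ ≤ 1 / (n.factorial : ℝ)) {z : 𝕜} {R : ℝ}
    (hz : ‖z‖ ≤ R) (n : ℕ) : ‖a n * z ^ n‖ ≤ R ^ n / (n.factorial : ℝ) := by
  rw [norm_mul, norm_pow]
  calc ‖a n‖ * ‖z‖ ^ n ≤ 1 / (n.factorial : ℝ) * R ^ n := by
        gcongr
        exact ha n
    _ = _ := by ring

theorem summable_term {a : ℕ → 𝕜} (ha : ∀ n, ‖a n‖ ≤ 1 / (n.factorial : ℝ)) (z : 𝕜) :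
    Summable fun n => a n * z ^ n :=
  Summable.of_norm_bounded (Real.summable_pow_div_factorial ‖z‖) (norm_term_le ha le_rfl)

theorem hasDerivAt_entireSeries {a : ℕ → 𝕜} (ha : ∀ n, ‖a n‖ ≤ 1 / (n.factorial : ℝ)) (z : 𝕜) :
    HasDerivAt (fun z => ∑' n, a n * z ^ n) (∑' n, derivCoeff a n * z ^ n) z := by
  set R := ‖z‖ + 1
  have hR : 0 ≤ R := by positivity
  have hconv : IsPreconnected (Metric.ball (0 : 𝕜) R) := by
    let _ : NormedSpace ℝ 𝕜 := NormedSpace.restrictScalars ℝ 𝕜 𝕜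
    exact (convex_ball (0 : 𝕜) R).isPreconnected
  have hu : Summable fun n : ℕ => (n : ℝ) * R ^ (n - 1) / n.factorial := by
    rw [← summable_nat_add_iff 1]
    refine (Real.summable_pow_div_factorial R).congr fun n => ?_
    rw [Nat.factorial_succ]
    push_cast
    field_simp
  have h := hasDerivAt_tsum_of_isPreconnected (g := fun n z => a n * z ^ n)
    (g' := fun n z => a n * ((n : 𝕜) * z ^ (n - 1))) (y₀ := 0) (y := z) hu Metric.isOpen_ball hconv
    (fun n y _ => (hasDerivAt_pow n y).const_mul (a n)) ?_ (by simp [R]; positivity)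
    (summable_term ha 0) (by simp [R])
  · convert! h using 1
    have hs : Summable fun n => a n * ((n : 𝕜) * z ^ (n - 1)) := by
      rw [← summable_nat_add_iff 1]
      refine (summable_term (norm_derivCoeff_le ha) z).congr fun n => ?_
      simp [derivCoeff]
      ring
    rw [hs.tsum_eq_zero_add]
    simp only [Nat.cast_zero, zero_mul, mul_zero, zero_add]
    refine tsum_congr fun n => ?_
    simp [derivCoeff]
    ring
  · intro n y hy
    rw [mem_ball_zero_iff] at hy
    rw [norm_mul, norm_mul, norm_pow, RCLike.norm_natCast]
    calc ‖a n‖ * ((n : ℝ) * ‖y‖ ^ (n - 1)) ≤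
          1 / (n.factorial : ℝ) * ((n : ℝ) * R ^ (n - 1)) := by
          gcongr
          exact ha n
      _ = _ := by ring

/-- The operator `z ∂² + ∂` on power series. -/
theorem entireSeries_bessel {a : ℕ → 𝕜} (ha : ∀ n, ‖a n‖ ≤ 1 / (n.factorial : ℝ)) (z : 𝕜) :
    z * (∑' n, derivCoeff (derivCoeff a) n * z ^ n) + ∑' n, derivCoeff a n * z ^ n =
      ∑' n : ℕ, ((n : 𝕜) + 1) ^ 2 * a (n + 1) * z ^ n := by
  have h1 := norm_derivCoeff_le ha
  have h2 := summable_term (norm_derivCoeff_le h1) z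
  have hs : Summable fun n : ℕ => (n : 𝕜) * derivCoeff a n * z ^ n := by
    rw [← summable_nat_add_iff 1]
    refine (h2.mul_left z).congr fun n => ?_
    simp [derivCoeff]
    ring
  have h3 : z * (∑' n, derivCoeff (derivCoeff a) n * z ^ n) =
      ∑' n : ℕ, (n : 𝕜) * derivCoeff a n * z ^ n := by
    rw [hs.tsum_eq_zero_add, ← tsum_mul_left]
    simp only [Nat.cast_zero, zero_mul, zero_add]
    refine tsum_congr fun n => ?_
    simp [derivCoeff]
    ring
  rw [h3, ← hs.tsum_add (summable_term h1 z)]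
  refine tsum_congr fun n => ?_
  simp [derivCoeff]
  ring

end EntireSeries

/-! ### The Bessel equation for $J_0$ and $Y_0$ in the variable $\zeta=t^2/4$ -/

section Bessel

/-- Coefficients of `J₀(t) = ∑ aₙ (t²/4)ⁿ`. -/
def coeffJ (n : ℕ) : ℝ := (-1) ^ n / (n.factorial : ℝ) ^ 2

/-- Coefficients of the entire part of `Y₀`. -/
def coeffY (n : ℕ) : ℝ := (-1) ^ n * (harmonic n : ℝ) / (n.factorial : ℝ) ^ 2

/-- The entire function `∑ aₙ ζⁿ` with `J₀(t) = seriesJ (t²/4)`. -/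
def seriesJ (ζ : ℝ) : ℝ := ∑' n, coeffJ n * ζ ^ n

/-- The entire part of `Y₀`, as a function of `t²/4`. -/
def seriesY (ζ : ℝ) : ℝ := ∑' n, coeffY n * ζ ^ n

theorem norm_coeffJ (n : ℕ) : ‖coeffJ n‖ ≤ 1 / (n.factorial : ℝ) := coeffJ_bound n

theorem norm_coeffY (n : ℕ) : ‖coeffY n‖ ≤ 1 / (n.factorial : ℝ) := coeffY_bound n

theorem besselJ0_eq (t : ℝ) : besselJ0 t = seriesJ (t ^ 2 / 4) := by
  unfold besselJ0 seriesJ coeffJ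
  refine tsum_congr fun n => ?_
  rw [pow_mul]
  congr 2
  ring

theorem besselY0_eq (t : ℝ) : besselY0 t =
    2 / Real.pi * ((Real.log (t / 2) + Real.eulerMascheroniConstant) * seriesJ (t ^ 2 / 4) -
      seriesY (t ^ 2 / 4)) := by
  unfold besselY0
  rw [besselJ0_eq, mul_sub, ← mul_assoc]
  congr 2
  unfold seriesY coeffY
  refine tsum_congr fun n => ?_
  rw [pow_mul]
  congr 2
  ring

theorem coeffJ_succ (n : ℕ) : ((n : ℝ) + 1) ^ 2 * coeffJ (n + 1) = -coeffJ n := by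
  unfold coeffJ
  rw [Nat.factorial_succ]
  push_cast
  field_simp
  ring

/-- The increment $1/(n+1)$ of the harmonic numbers produces the inhomogeneity $J'$, exactly what
the logarithm contributes in `exists_isBesselSolution_Y`. -/
theorem coeffY_succ (n : ℕ) :
    ((n : ℝ) + 1) ^ 2 * coeffY (n + 1) = -coeffY n + derivCoeff coeffJ n := by
  unfold coeffY derivCoeff coeffJ
  rw [Nat.factorial_succ, harmonic_succ]
  push_cast
  have : (n.factorial : ℝ) ≠ 0 := by exact_mod_cast n.factorial_ne_zero
  field_simp
  ring

/-- `φ` solves `ζ φ'' + φ' + φ = 0` on the positive half-line. -/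
def IsBesselSolution (φ φ₁ φ₂ : ℝ → ℝ) : Prop :=
  ∀ ζ : ℝ, 0 < ζ → HasDerivAt φ (φ₁ ζ) ζ ∧ HasDerivAt φ₁ (φ₂ ζ) ζ ∧ ζ * φ₂ ζ + φ₁ ζ + φ ζ = 0

theorem isBesselSolution_seriesJ :
    IsBesselSolution seriesJ (fun ζ => ∑' n, derivCoeff coeffJ n * ζ ^ n)
      (fun ζ => ∑' n, derivCoeff (derivCoeff coeffJ) n * ζ ^ n) := by
  intro ζ _
  refine ⟨hasDerivAt_entireSeries norm_coeffJ ζ,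
    hasDerivAt_entireSeries (norm_derivCoeff_le norm_coeffJ) ζ, ?_⟩
  rw [entireSeries_bessel norm_coeffJ]
  simp only [coeffJ_succ, neg_mul, tsum_neg]
  simp [seriesJ]

/-- Applying $\zeta\partial^2+\partial+1$ to $(\frac12\log\zeta+c)J$ leaves only $J'$, which the
series of $Y$ cancels. With $\zeta=t^2/4$ the term $\frac12\log\zeta$ is $\log(t/2)$, so Euler's
constant as $c$ gives $Y_0$ up to the factor $2/\pi$. -/
theorem exists_isBesselSolution_Y (c : ℝ) : ∃ φ₁ φ₂ : ℝ → ℝ,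
    IsBesselSolution (fun ζ => (Real.log ζ / 2 + c) * seriesJ ζ - seriesY ζ) φ₁ φ₂ := by
  set f₁ : ℝ → ℝ := fun ζ => ∑' n, derivCoeff coeffJ n * ζ ^ n with hf₁
  set f₂ : ℝ → ℝ := fun ζ => ∑' n, derivCoeff (derivCoeff coeffJ) n * ζ ^ n with hf₂
  set g₁ : ℝ → ℝ := fun ζ => ∑' n, derivCoeff coeffY n * ζ ^ n with hg₁
  set g₂ : ℝ → ℝ := fun ζ => ∑' n, derivCoeff (derivCoeff coeffY) n * ζ ^ n with hg₂
  refine ⟨fun ζ => ζ⁻¹ / 2 * seriesJ ζ + (Real.log ζ / 2 + c) * f₁ ζ - g₁ ζ,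
    fun ζ => -(ζ ^ 2)⁻¹ / 2 * seriesJ ζ + ζ⁻¹ / 2 * f₁ ζ +
      (ζ⁻¹ / 2 * f₁ ζ + (Real.log ζ / 2 + c) * f₂ ζ) - g₂ ζ, ?_⟩
  intro ζ hζ
  obtain ⟨hJ1, hJ2, hJ3⟩ := isBesselSolution_seriesJ ζ hζ
  have hY1 : HasDerivAt seriesY (g₁ ζ) ζ := hasDerivAt_entireSeries norm_coeffY ζ
  have hY2 : HasDerivAt g₁ (g₂ ζ) ζ :=
    hasDerivAt_entireSeries (norm_derivCoeff_le norm_coeffY) ζ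
  have hY3 : ζ * g₂ ζ + g₁ ζ = -seriesY ζ + f₁ ζ := by
    rw [hg₁, hg₂, entireSeries_bessel norm_coeffY]
    simp only [coeffY_succ, add_mul, neg_mul]
    rw [Summable.tsum_add (summable_term norm_coeffY ζ).neg
      (summable_term (norm_derivCoeff_le norm_coeffJ) ζ), tsum_neg]
    rfl
  have hlog : HasDerivAt (fun ζ => Real.log ζ / 2 + c) (ζ⁻¹ / 2) ζ :=
    ((Real.hasDerivAt_log hζ.ne').div_const 2).add_const c
  have hinv : HasDerivAt (fun ζ : ℝ => ζ⁻¹ / 2) (-(ζ ^ 2)⁻¹ / 2) ζ :=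
    (hasDerivAt_inv hζ.ne').div_const 2
  refine ⟨(hlog.mul hJ1).sub hY1, ((hinv.mul hJ1).add (hlog.mul hJ2)).sub hY2, ?_⟩
  have e1 : ζ * (-(ζ ^ 2)⁻¹ / 2 * seriesJ ζ + ζ⁻¹ / 2 * f₁ ζ +
      (ζ⁻¹ / 2 * f₁ ζ + (Real.log ζ / 2 + c) * f₂ ζ) - g₂ ζ) =
      -ζ⁻¹ / 2 * seriesJ ζ + f₁ ζ + (Real.log ζ / 2 + c) * (ζ * f₂ ζ) - ζ * g₂ ζ := by
    field_simp
    ring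
  rw [e1]
  have hJ3' : ζ * f₂ ζ = -f₁ ζ - seriesJ ζ := by linarith
  rw [hJ3']
  linear_combination -hY3

/-- Liouville transformation: `w(t) = √t φ(t²/4)` solves `w'' + (1 + 1/(4t²)) w = 0`. -/
theorem IsBesselSolution.liouville {φ φ₁ φ₂ : ℝ → ℝ} (h : IsBesselSolution φ φ₁ φ₂) :
    ∃ w₁ : ℝ → ℝ, ∀ t : ℝ, 0 < t →
      HasDerivAt (fun t => Real.sqrt t * φ (t ^ 2 / 4)) (w₁ t) t ∧
      HasDerivAt w₁ (-(1 + 1 / (4 * t ^ 2)) * (Real.sqrt t * φ (t ^ 2 / 4))) t := by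
  refine ⟨fun t => 1 / (2 * Real.sqrt t) * φ (t ^ 2 / 4) +
    Real.sqrt t * (φ₁ (t ^ 2 / 4) * (t / 2)), fun t ht => ?_⟩
  obtain ⟨h1, h2, h3⟩ := h (t ^ 2 / 4) (by positivity)
  have hq : HasDerivAt (fun t : ℝ => t ^ 2 / 4) (t / 2) t := by
    have := (hasDerivAt_pow 2 t).div_const 4
    convert! this using 1
    norm_num
    ring
  have hs := Real.hasDerivAt_sqrt ht.ne'
  have d1 := HasDerivAt.comp t h1 hq
  have d2 := HasDerivAt.comp t h2 hq
  have hst : Real.sqrt t ≠ 0 := (Real.sqrt_pos.2 ht).ne'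
  have hsi := ((hs.const_mul 2).inv (by positivity))
  have hh : HasDerivAt (fun t : ℝ => t / 2) (1 / 2) t := (hasDerivAt_id t).div_const 2
  refine ⟨hs.mul d1, ?_⟩
  have := ((hsi.mul d1).add (hs.mul (d2.mul hh)))
  simp only [Function.comp_def] at this
  convert! this using 1
  · funext t
    simp
  -- Writing $t=s^2$ with $s=\sqrt t$ and eliminating $\varphi$ by the Bessel equation turns the
  -- claim into a rational identity in $s$.
  · have hsq : t = Real.sqrt t ^ 2 := (Real.sq_sqrt ht.le).symm
    have h3' : φ (t ^ 2 / 4) = -(t ^ 2 / 4 * φ₂ (t ^ 2 / 4)) - φ₁ (t ^ 2 / 4) := by linarith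
    simp only [Pi.inv_apply, Pi.mul_apply]
    rw [h3']
    clear h3' h3 h1 h2 d1 d2 this hs hsi
    generalize φ₂ (t ^ 2 / 4) = p2
    generalize φ₁ (t ^ 2 / 4) = p1
    generalize Real.sqrt t = s at *
    subst hsq
    field_simp
    ring

end Bessel

/-! ### Oscillatory asymptotics of $H_0^{(1)}$ from the Liouville normal form -/

section Asymptotics

/-- The equation `w'' + (1 + 1/(4t²)) w = 0` on the positive half-line, with `w₁ = w'`. -/
def IsLiouvilleSolution (w w₁ : ℝ → ℝ) : Prop :=
  ∀ t : ℝ, 0 < t → HasDerivAt w (w₁ t) t ∧ HasDerivAt w₁ (-(1 + 1 / (4 * t ^ 2)) * w t) t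

/-- Grönwall for the energy $E=w'^2+w^2$: since $E'=-2ww'/(4x^2)$ and $|2ww'|\le E$, the function
$E\,e^{1/(4x)}$ decreases and $E\,e^{-1/(4x)}$ increases. The upper bound controls $w$ at infinity,
the lower one prevents a nonzero solution from decaying. -/
theorem IsLiouvilleSolution.energy_bounds {w w₁ : ℝ → ℝ} (h : IsLiouvilleSolution w w₁) {s t : ℝ}
    (hs : 0 < s) (hst : s ≤ t) :
    w₁ t ^ 2 + w t ^ 2 ≤ (w₁ s ^ 2 + w s ^ 2) * Real.exp (1 / (4 * s)) ∧
      (w₁ s ^ 2 + w s ^ 2) * Real.exp (-(1 / (4 * s))) ≤ w₁ t ^ 2 + w t ^ 2 := by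
  have hE : ∀ x : ℝ, 0 < x → HasDerivAt (fun x => w₁ x ^ 2 + w x ^ 2)
      (-(2 * w x * w₁ x) * (1 / (4 * x ^ 2))) x := by
    intro x hx
    obtain ⟨h1, h2⟩ := h x hx
    convert! (h2.pow 2).add (h1.pow 2) using 1
    simp
    ring
  have hI : ∀ x : ℝ, 0 < x → HasDerivAt (fun x : ℝ => 1 / (4 * x)) (-(1 / (4 * x ^ 2))) x := by
    intro x hx
    have h1 := ((hasDerivAt_id x).const_mul 4).inv (by simp; exact hx.ne')
    convert! h1 using 1
    · funext y
      simp
    · simp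
      field_simp
  have hup : ∀ x : ℝ, 0 < x → HasDerivAt (fun x => (w₁ x ^ 2 + w x ^ 2) * Real.exp (1 / (4 * x)))
      ((-(2 * w x * w₁ x) - (w₁ x ^ 2 + w x ^ 2)) * (1 / (4 * x ^ 2)) *
        Real.exp (1 / (4 * x))) x := by
    intro x hx
    convert! (hE x hx).mul (hI x hx).exp using 1
    ring
  have hlo : ∀ x : ℝ, 0 < x → HasDerivAt
      (fun x => (w₁ x ^ 2 + w x ^ 2) * Real.exp (-(1 / (4 * x))))
      ((-(2 * w x * w₁ x) + (w₁ x ^ 2 + w x ^ 2)) * (1 / (4 * x ^ 2)) *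
        Real.exp (-(1 / (4 * x)))) x := by
    intro x hx
    convert! (hE x hx).mul (hI x hx).neg.exp using 1
    simp only [Pi.neg_apply]
    ring
  have ht : 0 < t := hs.trans_le hst
  have hanti : AntitoneOn (fun x => (w₁ x ^ 2 + w x ^ 2) * Real.exp (1 / (4 * x))) (Set.Ici s) := by
    refine antitoneOn_of_deriv_nonpos (convex_Ici s)
      (fun x hx => (hup x (hs.trans_le hx)).continuousAt.continuousWithinAt)
      (fun x hx => ?_) (fun x hx => ?_)
    · rw [interior_Ici] at hx
      exact (hup x (hs.trans hx)).differentiableAt.differentiableWithinAt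
    · rw [interior_Ici] at hx
      rw [(hup x (hs.trans hx)).deriv]
      refine mul_nonpos_of_nonpos_of_nonneg (mul_nonpos_of_nonpos_of_nonneg ?_ (by positivity))
        (by positivity)
      nlinarith [sq_nonneg (w x + w₁ x)]
  have hmono : MonotoneOn (fun x => (w₁ x ^ 2 + w x ^ 2) * Real.exp (-(1 / (4 * x))))
      (Set.Ici s) := by
    refine monotoneOn_of_deriv_nonneg (convex_Ici s)
      (fun x hx => (hlo x (hs.trans_le hx)).continuousAt.continuousWithinAt)
      (fun x hx => ?_) (fun x hx => ?_)
    · rw [interior_Ici] at hx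
      exact (hlo x (hs.trans hx)).differentiableAt.differentiableWithinAt
    · rw [interior_Ici] at hx
      rw [(hlo x (hs.trans hx)).deriv]
      refine mul_nonneg (mul_nonneg ?_ (by positivity)) (by positivity)
      nlinarith [sq_nonneg (w x - w₁ x)]
  have hpos : 0 ≤ w₁ t ^ 2 + w t ^ 2 := by positivity
  constructor
  · refine le_trans ?_ (hanti (Set.self_mem_Ici) hst hst)
    exact le_mul_of_one_le_right hpos (Real.one_le_exp (by positivity))
  · refine (hmono (Set.self_mem_Ici) hst hst).trans ?_
    refine mul_le_of_le_one_right hpos (Real.exp_le_one_iff.2 ?_)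
    have : 0 < 1 / (4 * t) := by positivity
    linarith

/-- Variation of constants: $F=(w'+iw)e^{-it}$ would be constant for $w''+w=0$. Here
$F'=-we^{-it}/(4t^2)$ is integrable at infinity because $w$ is bounded, so $F$ has a limit $A$, and
$w=\operatorname{Im}(Fe^{it})$ approaches $\operatorname{Im}(Ae^{it})$. As $|F|^2$ is the energy,
its lower bound gives $A\ne0$ for a nonzero solution. -/
theorem IsLiouvilleSolution.exists_asymptotics {w w₁ : ℝ → ℝ} (h : IsLiouvilleSolution w w₁) :
    ∃ A : ℂ, Tendsto (fun t : ℝ => (w t : ℂ) - (A * Complex.exp (t * Complex.I) -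
        star A * Complex.exp (-(t * Complex.I))) / (2 * Complex.I)) atTop (𝓝 0) ∧
      ∀ t, 0 < t → w t ≠ 0 → A ≠ 0 := by
  set F : ℝ → ℂ := fun t => (w₁ t + w t * Complex.I) * Complex.exp (-(t * Complex.I)) with hF
  have hFn : ∀ t, ‖F t‖ ^ 2 = w₁ t ^ 2 + w t ^ 2 := by
    intro t
    have : ‖Complex.exp (-(t * Complex.I))‖ = 1 := by
      rw [Complex.norm_exp]
      simp
    rw [hF, norm_mul, this, mul_one, Complex.sq_norm, Complex.normSq_add_mul_I]
  set F' : ℝ → ℂ := fun t =>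
    -((1 / (4 * t ^ 2) : ℝ) * w t : ℂ) * Complex.exp (-(t * Complex.I)) with hF'
  have hd : ∀ t : ℝ, 0 < t → HasDerivAt F (F' t) t := by
    intro t ht
    obtain ⟨h1, h2⟩ := h t ht
    have he : HasDerivAt (fun t : ℝ => Complex.exp (-(t * Complex.I)))
        (Complex.exp (-(t * Complex.I)) * -(1 * Complex.I)) t := by
      have := ((Complex.ofRealCLM.hasDerivAt (x := t)).mul_const Complex.I).neg.cexp
      simpa using this
    convert! (h2.ofReal_comp.add (h1.ofReal_comp.mul_const Complex.I)).mul he using 1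
    simp only [hF', Pi.add_apply]
    push_cast
    linear_combination ((w t) * Complex.exp (-(t * Complex.I)) : ℂ) * Complex.I_sq
  set K := Real.sqrt ((w₁ 1 ^ 2 + w 1 ^ 2) * Real.exp (1 / (4 * 1))) with hK
  have hw : ∀ t, 1 ≤ t → |w t| ≤ K := by
    intro t ht
    refine Real.abs_le_sqrt ?_
    have := (h.energy_bounds one_pos ht).1
    nlinarith [sq_nonneg (w₁ t)]
  have hint : IntegrableOn F' (Set.Ioi 1) := by
    have hb : IntegrableOn (fun t : ℝ => K / 4 * t ^ (-2 : ℝ)) (Set.Ioi 1) :=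
      (integrableOn_Ioi_rpow_of_lt (by norm_num) one_pos).const_mul _
    refine Integrable.mono' hb ?_ ?_
    · refine ContinuousOn.aestronglyMeasurable (fun t ht => ?_) measurableSet_Ioi
      have ht0 : 0 < t := one_pos.trans ht
      refine ContinuousAt.continuousWithinAt ?_
      have hc := (h t ht0).1.continuousAt
      have hc2 : ContinuousAt (fun t : ℝ => (((1 / (4 * t ^ 2) : ℝ)) : ℂ)) t := by
        refine Complex.continuous_ofReal.continuousAt.comp ?_
        exact ContinuousAt.div continuousAt_const (by fun_prop) (by positivity)
      exact (hc2.mul (Complex.continuous_ofReal.continuousAt.comp hc)).neg.mul (by fun_prop)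
    · filter_upwards [ae_restrict_mem measurableSet_Ioi] with t ht
      have ht0 : 0 < t := one_pos.trans ht
      have : ‖Complex.exp (-(t * Complex.I))‖ = 1 := by
        rw [Complex.norm_exp]
        simp
      rw [hF', norm_mul, this, mul_one, norm_neg, norm_mul, Complex.norm_real, Complex.norm_real,
        Real.norm_of_nonneg (by positivity), Real.norm_eq_abs, Real.rpow_neg ht0.le, Real.rpow_two]
      calc 1 / (4 * t ^ 2) * |w t| ≤ 1 / (4 * t ^ 2) * K := by
            gcongr
            exact hw t (le_of_lt ht)
        _ = _ := by
            field_simp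
  have hlim := tendsto_limUnder_of_hasDerivAt_of_integrableOn_Ioi
    (fun t ht => hd t (one_pos.trans ht)) hint
  set A := limUnder atTop F
  have hexp : ∀ t : ℝ, Complex.exp (-(t * Complex.I)) * Complex.exp (t * Complex.I) = 1 := by
    intro t
    rw [← Complex.exp_add]
    simp
  have hnorm1 : ∀ t : ℝ, ‖Complex.exp (t * Complex.I)‖ = 1 := Complex.norm_exp_ofReal_mul_I
  have hnorm2 : ∀ t : ℝ, ‖Complex.exp (-(t * Complex.I))‖ = 1 := by
    intro t
    rw [Complex.norm_exp]
    simp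
  refine ⟨A, ?_, ?_⟩
  · have hz : Tendsto (fun t => ‖F t - A‖) atTop (𝓝 0) := by
      simpa using (hlim.sub_const A).norm
    refine squeeze_zero_norm (fun t => ?_) hz
    have e : (w t : ℂ) - (A * Complex.exp (t * Complex.I) -
        star A * Complex.exp (-(t * Complex.I))) / (2 * Complex.I) =
        ((F t - A) * Complex.exp (t * Complex.I) -
          star (F t - A) * Complex.exp (-(t * Complex.I))) / (2 * Complex.I) := by
      have hst : star (F t) = (w₁ t - w t * Complex.I) * Complex.exp (t * Complex.I) := by
        simp [hF, ← Complex.exp_conj, sub_eq_add_neg]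
      rw [star_sub, hst, hF]
      field_simp
      linear_combination (-2 * w t * Complex.I : ℂ) * hexp t
    rw [e, norm_div]
    have : ‖(2 * Complex.I : ℂ)‖ = 2 := by simp
    rw [this, div_le_iff₀ two_pos]
    refine (norm_sub_le _ _).trans ?_
    rw [norm_mul, norm_mul, hnorm1, hnorm2, norm_star]
    linarith
  · intro s hs hws hA
    have hl2 : Tendsto (fun t => ‖F t‖ ^ 2) atTop (𝓝 0) := by
      have := (hlim.norm).pow 2
      simpa [hA] using this
    have hge : (w₁ s ^ 2 + w s ^ 2) * Real.exp (-(1 / (4 * s))) ≤ 0 := by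
      refine ge_of_tendsto hl2 ?_
      filter_upwards [eventually_ge_atTop s] with t ht
      rw [hFn]
      exact (h.energy_bounds hs ht).2
    have : 0 < w s ^ 2 := by positivity
    have : 0 < (w₁ s ^ 2 + w s ^ 2) * Real.exp (-(1 / (4 * s))) := by positivity
    linarith

theorem seriesJ_ne_zero : ∃ t : ℝ, 0 < t ∧ Real.sqrt t * seriesJ (t ^ 2 / 4) ≠ 0 := by
  have hc : ContinuousAt (fun t : ℝ => seriesJ (t ^ 2 / 4)) 0 := by
    have h1 := (hasDerivAt_entireSeries norm_coeffJ ((0 : ℝ) ^ 2 / 4)).continuousAt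
    exact ContinuousAt.comp (f := fun t : ℝ => t ^ 2 / 4) h1 (by fun_prop)
  have h0 : seriesJ ((0 : ℝ) ^ 2 / 4) ≠ 0 := by
    have : seriesJ 0 = 1 := by
      unfold seriesJ
      rw [tsum_eq_single 0 (fun n hn => by simp [hn])]
      simp [coeffJ]
    simp [this]
  obtain ⟨t, ht, ht0⟩ := (((hc.eventually_ne h0).filter_mono nhdsWithin_le_nhds).and
    (self_mem_nhdsWithin : Set.Ioi (0 : ℝ) ∈ 𝓝[>] 0)).exists
  exact ⟨t, ht0, mul_ne_zero (Real.sqrt_pos.2 ht0).ne' ht⟩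

/-- The leading order behaviour of the Hankel function, up to the values of the constants. -/
theorem exists_hankelH0_asymptotics : ∃ a b : ℂ, (a ≠ 0 ∨ b ≠ 0) ∧
    Tendsto (fun t : ℝ => (Real.sqrt t : ℂ) * hankelH0 t - (a * Complex.exp (t * Complex.I) +
      b * Complex.exp (-(t * Complex.I)))) atTop (𝓝 0) := by
  obtain ⟨w₁, hw⟩ := isBesselSolution_seriesJ.liouville
  obtain ⟨A, hA, hA0⟩ := IsLiouvilleSolution.exists_asymptotics hw
  obtain ⟨φ₁, φ₂, hφ⟩ := exists_isBesselSolution_Y Real.eulerMascheroniConstant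
  obtain ⟨v₁, hv⟩ := hφ.liouville
  obtain ⟨B, hB, -⟩ := IsLiouvilleSolution.exists_asymptotics hv
  obtain ⟨s, hs, hs0⟩ := seriesJ_ne_zero
  have hAne := hA0 s hs hs0
  set c : ℂ := 2 / Real.pi with hc
  -- $A$ and $B$ are the amplitudes of the Liouville transforms of $J_0$ and of $Y_0/c$ with
  -- $c=2/\pi$; the witnesses collect $e^{it}$ and $e^{-it}$ in
  -- $\operatorname{Im}(Ae^{it})+ic\operatorname{Im}(Be^{it})$.
  refine ⟨(A + Complex.I * (c * B)) / (2 * Complex.I),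
    -(star A + Complex.I * (c * star B)) / (2 * Complex.I), ?_, ?_⟩
  -- If both coefficients vanish, then $A+icB=0$ and, conjugating the second relation, $A-icB=0$.
  -- Hence $A=0$, although $J_0$ is not identically zero.
  · by_contra! hcon
    obtain ⟨h1, h2⟩ := hcon
    have hI : (2 * Complex.I : ℂ) ≠ 0 := by simp
    have e1 : A + Complex.I * (c * B) = 0 := by simpa [hI] using h1
    have e2 : star A + Complex.I * (c * star B) = 0 := by
      rw [div_eq_zero_iff, neg_eq_zero] at h2
      exact h2.resolve_right hI
    have e3 := congrArg star e2
    have hcs : star c = c := by simp [hc]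
    simp only [star_add, star_mul', star_star, hcs, star_zero] at e3
    have : star Complex.I = -Complex.I := Complex.conj_I
    rw [this] at e3
    exact hAne (by linear_combination (e1 + e3) / 2)
  · have := hA.add (hB.const_mul (Complex.I * c))
    rw [mul_zero, add_zero] at this
    refine this.congr' ?_
    filter_upwards [eventually_gt_atTop 0] with t ht
    have hlog : Real.log (t ^ 2 / 4) / 2 = Real.log (t / 2) := by
      have : t ^ 2 / 4 = (t / 2) ^ 2 := by ring
      rw [this, Real.log_pow]
      simp
    rw [hlog, hankelH0, besselJ0_eq, besselY0_eq, hc]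
    push_cast
    ring

end Asymptotics

/-! ### A common form of the Green's function for $d=2$ and $d=3$ -/

section Profile

/-- A radial function `r ↦ Ψ(r²)`, with `Ψ` holomorphic on the right half-plane, which behaves like
`r⁻ᵖ (a exp(ir) + b exp(-ir))` at infinity. -/
structure OscillatingProfile where
  Ψ : ℂ → ℂ
  p : ℝ
  a : ℂ
  b : ℂ
  p_nonneg : 0 ≤ p
  differentiableOn : DifferentiableOn ℂ Ψ {z | 0 < z.re}
  coeff_ne_zero : a ≠ 0 ∨ b ≠ 0
  tendsto : Tendsto (fun t : ℝ => ((t ^ p : ℝ) : ℂ) * Ψ ((t ^ 2 : ℝ) : ℂ) -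
    (a * Complex.exp (t * Complex.I) + b * Complex.exp (-(t * Complex.I)))) atTop (𝓝 0)

/-- The profile `exp(ir)/r`. -/
def sphericalProfile : OscillatingProfile where
  Ψ z := Complex.exp (Complex.I * z ^ (1 / 2 : ℂ)) / z ^ (1 / 2 : ℂ)
  p := 1
  a := 1
  b := 0
  p_nonneg := zero_le_one
  differentiableOn := by
    intro z hz
    have hz' : 0 < z.re := hz
    have hs : z ∈ Complex.slitPlane := Or.inl hz'
    have hd : DifferentiableAt ℂ (fun z : ℂ => z ^ (1 / 2 : ℂ)) z :=
      (hasStrictDerivAt_id z).hasDerivAt.cpow_const hs |>.differentiableAt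
    refine ((hd.const_mul _).cexp.div hd ?_).differentiableWithinAt
    rw [Complex.cpow_ne_zero_iff]
    exact Or.inl fun h => by simp [h] at hz'
  coeff_ne_zero := Or.inl one_ne_zero
  tendsto := by
    refine tendsto_const_nhds.congr' ?_
    filter_upwards [eventually_gt_atTop 0] with t ht
    have h : ((t ^ 2 : ℝ) : ℂ) ^ (1 / 2 : ℂ) = t := by
      have : (1 / 2 : ℂ) = ((1 / 2 : ℝ) : ℂ) := by simp
      rw [this, ← Complex.ofReal_cpow (by positivity), ← Real.sqrt_eq_rpow, Real.sqrt_sq ht.le]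
    have ht' : (t : ℂ) ≠ 0 := by exact_mod_cast ht.ne'
    rw [h, Real.rpow_one, mul_comm Complex.I]
    field_simp
    simp

theorem differentiable_entireSeries {c : ℕ → ℝ} (hc : ∀ n, ‖c n‖ ≤ 1 / (n.factorial : ℝ)) :
    Differentiable ℂ fun z : ℂ => ∑' n, (c n : ℂ) * z ^ n := fun z =>
  (hasDerivAt_entireSeries (a := fun n => (c n : ℂ))
    (fun n => by rw [Complex.norm_real]; exact hc n) z).differentiableAt

theorem ofReal_series (c : ℕ → ℝ) (x : ℝ) :
    ∑' n, (c n : ℂ) * (x : ℂ) ^ n = ((∑' n, c n * x ^ n : ℝ) : ℂ) := by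
  rw [Complex.ofReal_tsum]
  push_cast
  rfl

/-- The Hankel function `H₀⁽¹⁾(√z)` on the right half-plane. -/
def hankelSq (z : ℂ) : ℂ :=
  (∑' n, (coeffJ n : ℂ) * (z / 4) ^ n) + Complex.I * (2 / Real.pi *
    ((Complex.log z / 2 - Real.log 2 + Real.eulerMascheroniConstant) *
      (∑' n, (coeffJ n : ℂ) * (z / 4) ^ n) - ∑' n, (coeffY n : ℂ) * (z / 4) ^ n))

theorem hankelSq_sq {t : ℝ} (ht : 0 < t) : hankelSq ((t ^ 2 : ℝ) : ℂ) = hankelH0 t := by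
  have h4 : ((t ^ 2 : ℝ) : ℂ) / 4 = ((t ^ 2 / 4 : ℝ) : ℂ) := by push_cast; rfl
  have hlog : Real.log (t / 2) = Real.log (t ^ 2) / 2 - Real.log 2 := by
    rw [Real.log_div ht.ne' two_ne_zero, Real.log_pow]
    simp
  rw [hankelSq, h4, ofReal_series, ofReal_series, ← Complex.ofReal_log (by positivity), hankelH0,
    besselJ0_eq, besselY0_eq, hlog, ← seriesJ, ← seriesY]
  push_cast
  rfl

/-- The profile of the Hankel function `H₀⁽¹⁾`. -/
theorem exists_cylindricalProfile : ∃ P : OscillatingProfile, P.Ψ = hankelSq := by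
  obtain ⟨a, b, hab, h⟩ := exists_hankelH0_asymptotics
  refine ⟨⟨hankelSq, 1 / 2, a, b, by norm_num, ?_, hab, ?_⟩, rfl⟩
  · intro z hz
    have hs : z ∈ Complex.slitPlane := Or.inl hz
    have hJ : DifferentiableAt ℂ (fun z : ℂ => ∑' n, (coeffJ n : ℂ) * (z / 4) ^ n) z :=
      ((differentiable_entireSeries norm_coeffJ).comp
        (differentiable_id.div_const (4 : ℂ))).differentiableAt
    have hY : DifferentiableAt ℂ (fun z : ℂ => ∑' n, (coeffY n : ℂ) * (z / 4) ^ n) z :=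
      ((differentiable_entireSeries norm_coeffY).comp
        (differentiable_id.div_const (4 : ℂ))).differentiableAt
    have hl : DifferentiableAt ℂ Complex.log z := Complex.differentiableAt_log hs
    refine DifferentiableAt.differentiableWithinAt ?_
    exact hJ.add (((((hl.div_const 2).sub_const _).add_const _).mul hJ |>.sub hY).const_mul _
      |>.const_mul _)
  · refine h.congr' ?_
    filter_upwards [eventually_gt_atTop 0] with t ht
    rw [hankelSq_sq ht, Real.sqrt_eq_rpow]

theorem machNorm_pos {d : ℕ} {m z : EuclideanSpace ℝ (Fin d)} (hm : ‖m‖ < 1) (hz : z ≠ 0) :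
    0 < machNorm m z :=
  (mul_pos (Real.sqrt_pos.2 (betaSq_pos hm)) (norm_pos_iff.2 hz)).trans_le (le_machNorm z)

/-- The argument of $\Psi$ is a quadratic form in $z$, with no square root. This is what allows $z$
to be moved into complex directions and $\Psi$ to be composed holomorphically. -/
theorem greenKernel_eq_profile {d : ℕ} (hd : d = 2 ∨ d = 3) {k : ℝ} (hk : 0 < k)
    {m : EuclideanSpace ℝ (Fin d)} (hm : ‖m‖ < 1) :
    ∃ P : OscillatingProfile, ∃ C : ℂ, C ≠ 0 ∧ ∀ z : EuclideanSpace ℝ (Fin d), z ≠ 0 →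
      greenKernel k m z = C * Complex.exp (-(Complex.I * ((k / betaSq m * inner ℝ z m : ℝ) : ℂ))) *
        P.Ψ (((k / betaSq m * machNorm m z) ^ 2 : ℝ) : ℂ) := by
  have hb := betaSq_pos hm
  have hκ : 0 < k / betaSq m := by positivity
  rcases hd with rfl | rfl
  · obtain ⟨P, hP⟩ := exists_cylindricalProfile
    refine ⟨P, Complex.I / ((4 * Real.sqrt (betaSq m) : ℝ) : ℂ), ?_, fun z hz => ?_⟩
    · have := (Real.sqrt_pos.2 hb).ne'
      simp [this]
    · rw [hP, hankelSq_sq (mul_pos hκ (machNorm_pos hm hz)), greenKernel, if_neg (by norm_num)]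
  · refine ⟨sphericalProfile, ((k / betaSq m / (4 * Real.pi) : ℝ) : ℂ), ?_, fun z hz => ?_⟩
    · have : k / betaSq m / (4 * Real.pi) ≠ 0 := by positivity
      exact_mod_cast this
    · have hN := machNorm_pos hm hz
      have h : (((k / betaSq m * machNorm m z) ^ 2 : ℝ) : ℂ) ^ (1 / 2 : ℂ) =
          ((k / betaSq m * machNorm m z : ℝ) : ℂ) := by
        have : (1 / 2 : ℂ) = ((1 / 2 : ℝ) : ℂ) := by simp
        rw [this, ← Complex.ofReal_cpow (by positivity), ← Real.sqrt_eq_rpow,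
          Real.sqrt_sq (by positivity)]
      have e : Complex.exp (Complex.I * ((k / betaSq m * (-(inner ℝ z m) + machNorm m z) : ℝ) : ℂ)) =
          Complex.exp (-(Complex.I * ((k / betaSq m * inner ℝ z m : ℝ) : ℂ))) *
            Complex.exp (Complex.I * ((k / betaSq m * machNorm m z : ℝ) : ℂ)) := by
        rw [← Complex.exp_add]
        congr 1
        push_cast
        ring
      have h1 : (((k / betaSq m : ℝ)) : ℂ) ≠ 0 := by exact_mod_cast hκ.ne'
      have h2 : ((machNorm m z : ℝ) : ℂ) ≠ 0 := by exact_mod_cast hN.ne'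
      have h3 : ((Real.pi : ℝ) : ℂ) ≠ 0 := by exact_mod_cast Real.pi_ne_zero
      rw [greenKernel, if_pos rfl, e]
      simp only [sphericalProfile]
      rw [h, Complex.ofReal_div (k / betaSq m) (4 * Real.pi),
        Complex.ofReal_mul (k / betaSq m) (machNorm m z)]
      generalize ((k / betaSq m : ℝ) : ℂ) = κ at *
      push_cast
      field_simp

end Profile

/-! ### Holomorphic dependence of integrals on a parameter -/

section HolomorphicParameter

/-- Differentiation under the integral sign needs a bound only on $F$ itself: Cauchy's estimate on
discs of radius $\rho$ bounds the derivative by $C/\rho$. -/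
theorem differentiableOn_integral_mul {Y : Type*} [MeasurableSpace Y] {μ : Measure Y} {v : Y → ℂ}
    (hv : Integrable v μ) {F : ℂ → Y → ℂ} {r C : ℝ}
    (hmeas : ∀ z ∈ Metric.ball (0 : ℂ) r, AEStronglyMeasurable (F z) μ)
    (hd : ∀ᵐ y ∂μ, DifferentiableOn ℂ (fun z => F z y) (Metric.ball 0 r))
    (hb : ∀ᵐ y ∂μ, ∀ z ∈ Metric.ball (0 : ℂ) r, ‖F z y‖ ≤ C) :
    DifferentiableOn ℂ (fun z => ∫ y, F z y * v y ∂μ) (Metric.ball 0 r) := by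
  intro z₀ hz₀
  obtain ⟨ρ', hρ', hsub'⟩ := Metric.isOpen_iff.1 Metric.isOpen_ball z₀ hz₀
  -- Discs of radius $\rho$ about points within $\rho$ of $z_0$ stay within $2\rho<\rho'$ of it,
  -- hence in the domain.
  set ρ := ρ' / 4 with hρdef
  have hρ : 0 < ρ := by positivity
  have hsub : ∀ z ∈ Metric.ball z₀ ρ, Metric.closedBall z ρ ⊆ Metric.ball 0 r := by
    intro z hz w hw
    refine hsub' ?_
    rw [Metric.mem_ball] at hz ⊢
    rw [Metric.mem_closedBall] at hw
    linarith [dist_triangle w z z₀]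
  have hnear : ∀ z ∈ Metric.ball z₀ ρ, z ∈ Metric.ball (0 : ℂ) r := fun z hz =>
    hsub z hz (Metric.mem_closedBall_self hρ.le)
  have hdA : ∀ᵐ y ∂μ, ∀ z ∈ Metric.ball (0 : ℂ) r,
      HasDerivAt (fun z => F z y) (deriv (fun z => F z y) z) z := by
    filter_upwards [hd] with y hy z hz
    exact (hy.differentiableAt (Metric.isOpen_ball.mem_nhds hz)).hasDerivAt
  have hz₀' : z₀ ∈ Metric.ball z₀ ρ := Metric.mem_ball_self hρ
  -- The derivative is measurable in $y$ as an a.e. limit of difference quotients along a sequence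
  -- tending to $z_0$. The shift $n+2$ keeps the sequence strictly inside the disc.
  have hmeas' : AEStronglyMeasurable (fun y => deriv (fun z => F z y) z₀) μ := by
    set u : ℕ → ℂ := fun n => z₀ + ((ρ / (n + 2) : ℝ) : ℂ) with hu
    have hun : ∀ n, u n ∈ Metric.ball z₀ ρ := by
      intro n
      rw [hu, Metric.mem_ball, dist_self_add_left, Complex.norm_real,
        Real.norm_of_nonneg (by positivity)]
      exact div_lt_self hρ (by linarith [(Nat.cast_nonneg n : (0 : ℝ) ≤ n)])
    have hune : ∀ n, u n ≠ z₀ := by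
      intro n hn
      have h1 : ((ρ / (n + 2) : ℝ) : ℂ) = 0 := by simpa [hu] using hn
      have h2 : ρ / ((n : ℝ) + 2) = 0 := by exact_mod_cast h1
      have : 0 < ρ / ((n : ℝ) + 2) := by positivity
      linarith
    have hut : Tendsto u atTop (𝓝[≠] z₀) := by
      refine tendsto_nhdsWithin_iff.2 ⟨?_, Eventually.of_forall hune⟩
      have h0 : Tendsto (fun n : ℕ => ρ / ((n : ℝ) + 2)) atTop (𝓝 0) :=
        Tendsto.div_atTop tendsto_const_nhds
          (tendsto_atTop_add_const_right _ _ tendsto_natCast_atTop_atTop)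
      have := (Complex.continuous_ofReal.tendsto _).comp h0
      simpa [hu, Function.comp_def] using this.const_add z₀
    refine aestronglyMeasurable_of_tendsto_ae atTop
      (f := fun n y => slope (fun z => F z y) z₀ (u n)) (fun n => ?_) ?_
    · simp only [slope, vsub_eq_sub]
      exact ((hmeas _ (hnear _ (hun n))).sub (hmeas _ hz₀)).const_smul ((u n - z₀)⁻¹)
    · filter_upwards [hdA] with y hy
      exact (hasDerivAt_iff_tendsto_slope.1 (hy z₀ hz₀)).comp hut
  have key := hasDerivAt_integral_of_dominated_loc_of_deriv_le (μ := μ) (𝕜 := ℂ)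
    (F := fun z y => F z y * v y) (F' := fun z y => deriv (fun z => F z y) z * v y)
    (bound := fun y => C / ρ * ‖v y‖) (x₀ := z₀) (Metric.ball_mem_nhds z₀ hρ) ?_ ?_ ?_ ?_ ?_ ?_
  · exact key.2.differentiableAt.differentiableWithinAt
  · filter_upwards [Metric.isOpen_ball.mem_nhds hz₀] with z hz
    exact (hmeas z hz).mul hv.1
  · refine Integrable.mono' (hv.norm.const_mul C) ((hmeas z₀ hz₀).mul hv.1) ?_
    filter_upwards [hb] with y hy
    rw [norm_mul]
    exact mul_le_mul_of_nonneg_right (hy z₀ hz₀) (norm_nonneg _)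
  · exact hmeas'.mul hv.1
  · filter_upwards [hb, hd] with y hy hdy z hz
    rw [norm_mul]
    refine mul_le_mul_of_nonneg_right ?_ (norm_nonneg _)
    refine Complex.norm_deriv_le_of_forall_mem_sphere_norm_le hρ ?_ ?_
    · refine DifferentiableOn.diffContOnCl ?_
      rw [closure_ball _ hρ.ne']
      exact hdy.mono (hsub z hz)
    · exact fun w hw => hy w (hsub z hz (Metric.sphere_subset_closedBall hw))
  · exact hv.norm.const_mul _
  · filter_upwards [hdA] with y hy z hz
    exact (hy z (hnear z hz)).mul_const _

end HolomorphicParameter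

/-! ### Unique continuation for functions analytic along lines -/

section UniqueContinuation

variable {E : Type*} [NormedAddCommGroup E] [NormedSpace ℝ E]

/-- `f` is real analytic along every line through every point of `U`. -/
def LineAnalyticOn (f : E → ℂ) (U : Set E) : Prop :=
  ∀ x ∈ U, ∀ w : E, AnalyticAt ℝ (fun s : ℝ => f (x + s • w)) 0

/-- On the segment from $p$ to $x$ the function is a one-variable analytic function vanishing near
the initial point, so the one-dimensional identity theorem suffices. -/
theorem LineAnalyticOn.eq_zero_of_convex {f : E → ℂ} {U V : Set E} (hf : LineAnalyticOn f U)
    (hV : Convex ℝ V) (hVU : V ⊆ U) {p : E} (hp : p ∈ V) (h0 : ∀ᶠ x in 𝓝 p, f x = 0) {x : E}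
    (hx : x ∈ V) : f x = 0 := by
  set g : ℝ → ℂ := fun t => f (p + t • (x - p)) with hg
  have hmem : ∀ t ∈ Set.Icc (0 : ℝ) 1, p + t • (x - p) ∈ V := fun t ht =>
    hV.add_smul_sub_mem hp hx ht
  have han : AnalyticOnNhd ℝ g (Set.Icc 0 1) := by
    intro t ht
    have h1 := hf _ (hVU (hmem t ht)) (x - p)
    have h2 : AnalyticAt ℝ (fun s : ℝ => s - t) t := analyticAt_id.sub analyticAt_const
    have h3 : AnalyticAt ℝ (fun s : ℝ => f (p + t • (x - p) + s • (x - p))) (t - t) := by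
      rwa [sub_self]
    convert! h3.comp_of_eq h2 rfl using 1
    funext s
    simp only [hg, Function.comp]
    congr 1
    module
  have hev : g =ᶠ[𝓝 0] 0 := by
    have hc : ContinuousAt (fun t : ℝ => p + t • (x - p)) 0 := by fun_prop
    have : Tendsto (fun t : ℝ => p + t • (x - p)) (𝓝 0) (𝓝 p) := by simpa using hc.tendsto
    exact this.eventually h0
  have := han.eqOn_zero_of_preconnected_of_eventuallyEq_zero isPreconnected_Icc
    (Set.left_mem_Icc.2 zero_le_one) hev (Set.right_mem_Icc.2 zero_le_one)
  simpa [hg] using this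

/-- The interior $Z$ of the zero set is relatively closed in $U$: near a limit point $y\in U$ of
$Z$, a ball about $y$ in $U$ meets $Z$, and convexity spreads the zero over that ball. Connectedness
finishes. -/
theorem LineAnalyticOn.eq_zero {f : E → ℂ} {U M : Set E} (hf : LineAnalyticOn f U) (hU : IsOpen U)
    (hUc : IsPreconnected U) (hM : IsOpen M) (hMn : M.Nonempty) (hMU : M ⊆ U)
    (h0 : ∀ x ∈ M, f x = 0) {x : E} (hx : x ∈ U) : f x = 0 := by
  set Z : Set E := {x | ∀ᶠ y in 𝓝 x, f y = 0} with hZ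
  have hZo : IsOpen Z := isOpen_setOfPred_eventually_nhds
  have hsub : U ⊆ Z := by
    refine hUc.subset_of_closure_inter_subset hZo ?_ ?_
    · obtain ⟨p, hp⟩ := hMn
      exact ⟨p, hMU hp, by filter_upwards [hM.mem_nhds hp] with y hy using h0 y hy⟩
    · rintro y ⟨hy, hyU⟩
      obtain ⟨ε, hε, hεU⟩ := Metric.isOpen_iff.1 hU y hyU
      obtain ⟨p, hpZ, hp⟩ := Metric.mem_closure_iff.1 hy ε hε
      filter_upwards [Metric.ball_mem_nhds y hε] with z hz
      exact hf.eq_zero_of_convex (convex_ball y ε) hεU (by rwa [Metric.mem_ball, dist_comm]) hpZ hz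
  exact (hsub hx).self_of_nhds

end UniqueContinuation

/-! ### The inner product behind the Mach norm -/

section MachForm

variable {d : ℕ}

/-- The bilinear form with `machNorm m z ^ 2 = machForm m z z`. -/
def machForm (m z w : EuclideanSpace ℝ (Fin d)) : ℝ :=
  inner ℝ z m * inner ℝ w m + betaSq m * inner ℝ z w

variable {m : EuclideanSpace ℝ (Fin d)}

theorem machForm_comm (z w : EuclideanSpace ℝ (Fin d)) : machForm m z w = machForm m w z := by
  rw [machForm, machForm, real_inner_comm z w]
  ring

theorem machForm_add_left (z z' w : EuclideanSpace ℝ (Fin d)) :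
    machForm m (z + z') w = machForm m z w + machForm m z' w := by
  simp only [machForm, inner_add_left]
  ring

theorem machForm_sub_left (z z' w : EuclideanSpace ℝ (Fin d)) :
    machForm m (z - z') w = machForm m z w - machForm m z' w := by
  simp only [machForm, inner_sub_left]
  ring

theorem machForm_smul_left (s : ℝ) (z w : EuclideanSpace ℝ (Fin d)) :
    machForm m (s • z) w = s * machForm m z w := by
  simp only [machForm, real_inner_smul_left]
  ring

theorem machForm_add_right (w z z' : EuclideanSpace ℝ (Fin d)) :
    machForm m w (z + z') = machForm m w z + machForm m w z' := by
  simp only [machForm_comm w, machForm_add_left]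

theorem machForm_sub_right (w z z' : EuclideanSpace ℝ (Fin d)) :
    machForm m w (z - z') = machForm m w z - machForm m w z' := by
  simp only [machForm_comm w, machForm_sub_left]

theorem machForm_smul_right (s : ℝ) (w z : EuclideanSpace ℝ (Fin d)) :
    machForm m w (s • z) = s * machForm m w z := by
  simp only [machForm_comm w, machForm_smul_left]

theorem le_machForm_self (z : EuclideanSpace ℝ (Fin d)) : betaSq m * ‖z‖ ^ 2 ≤ machForm m z z := by
  rw [machForm, real_inner_self_eq_norm_sq]
  nlinarith [mul_self_nonneg (inner ℝ z m : ℝ)]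

theorem machForm_self_pos (hm : ‖m‖ < 1) {z : EuclideanSpace ℝ (Fin d)} (hz : z ≠ 0) :
    0 < machForm m z z :=
  (mul_pos (betaSq_pos hm) (pow_pos (norm_pos_iff.2 hz) 2)).trans_le (le_machForm_self z)

theorem machForm_self_nonneg (hm : ‖m‖ < 1) (z : EuclideanSpace ℝ (Fin d)) :
    0 ≤ machForm m z z :=
  (mul_nonneg (betaSq_pos hm).le (sq_nonneg _)).trans (le_machForm_self z)

theorem machNorm_eq_sqrt (z : EuclideanSpace ℝ (Fin d)) :
    machNorm m z = Real.sqrt (machForm m z z) := by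
  rw [machNorm, machForm, real_inner_self_eq_norm_sq, sq (inner ℝ z m : ℝ)]

theorem machNorm_sq (hm : ‖m‖ < 1) (z : EuclideanSpace ℝ (Fin d)) :
    machNorm m z ^ 2 = machForm m z z := by
  rw [machNorm_eq_sqrt, Real.sq_sqrt (machForm_self_nonneg hm z)]

theorem abs_machForm_le (hm : ‖m‖ < 1) (z w : EuclideanSpace ℝ (Fin d)) :
    |machForm m z w| ≤ ‖z‖ * ‖w‖ := by
  have h1 := abs_real_inner_le_norm z m
  have h2 := abs_real_inner_le_norm w m
  have h3 := abs_real_inner_le_norm z w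
  have hb := betaSq_pos hm
  calc |machForm m z w| ≤ |inner ℝ z m| * |inner ℝ w m| + betaSq m * |inner ℝ z w| := by
        rw [machForm]
        refine (abs_add_le _ _).trans ?_
        rw [abs_mul, abs_mul, abs_of_pos hb]
    _ ≤ (‖z‖ * ‖m‖) * (‖w‖ * ‖m‖) + betaSq m * (‖z‖ * ‖w‖) := by gcongr
    _ = ‖z‖ * ‖w‖ := by
        rw [betaSq]
        ring

theorem continuous_machForm_self :
    Continuous fun z : EuclideanSpace ℝ (Fin d) => machForm m z z := by
  unfold machForm
  fun_prop

end MachForm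

/-! ### Continuity and line analyticity of the potential off $\overline\Omega$ -/

section Potential

variable {d : ℕ} {k : ℝ} {m : EuclideanSpace ℝ (Fin d)}

theorem continuousOn_greenKernel (hd : d = 2 ∨ d = 3) (hk : 0 < k) (hm : ‖m‖ < 1) :
    ContinuousOn (greenKernel k m) {0}ᶜ := by
  obtain ⟨P, C, -, h⟩ := greenKernel_eq_profile hd hk hm
  have hκ : 0 < k / betaSq m := div_pos hk (betaSq_pos hm)
  refine ContinuousOn.congr ?_ (fun z hz => h z hz)
  refine ContinuousOn.mul (Continuous.continuousOn (by fun_prop)) ?_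
  refine P.differentiableOn.continuousOn.comp (t := {z | 0 < z.re}) ?_ ?_
  · have hc := continuous_machForm_self (m := m)
    have : Continuous fun z : EuclideanSpace ℝ (Fin d) =>
        (((k / betaSq m * machNorm m z) ^ 2 : ℝ) : ℂ) := by
      simp only [mul_pow, machNorm_sq hm]
      fun_prop
    exact this.continuousOn
  · intro z hz
    have : 0 < (k / betaSq m * machNorm m z) ^ 2 :=
      pow_pos (mul_pos hκ (machNorm_pos hm hz)) 2
    change 0 < (((k / betaSq m * machNorm m z) ^ 2 : ℝ) : ℂ).re
    rwa [Complex.ofReal_re]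

variable {Ω : Set (EuclideanSpace ℝ (Fin d))} {v : EuclideanSpace ℝ (Fin d) → ℂ}

/-- Points off the closure of a bounded set have a positive distance from it. -/
theorem exists_dist_bounds (hΩ : Bornology.IsBounded Ω) {x : EuclideanSpace ℝ (Fin d)}
    (hx : x ∈ (closure Ω)ᶜ) :
    ∃ δ R : ℝ, 0 < δ ∧ 0 < R ∧ ∀ y ∈ Ω, δ ≤ ‖x - y‖ ∧ ‖x - y‖ ≤ R := by
  obtain ⟨δ, hδ, hsub⟩ := Metric.isOpen_iff.1 isClosed_closure.isOpen_compl x hx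
  obtain ⟨r, hr⟩ := hΩ.exists_norm_le
  refine ⟨δ, ‖x‖ + |r| + 1, hδ, by positivity, fun y hy => ⟨?_, ?_⟩⟩
  · by_contra! hlt
    have hyb : y ∈ Metric.ball x δ := by
      rwa [Metric.mem_ball, dist_comm, dist_eq_norm]
    exact hsub hyb (subset_closure hy)
  · linarith [norm_sub_le x y, hr y hy, le_abs_self r]

theorem continuousOn_potential (hd : d = 2 ∨ d = 3) (hk : 0 < k) (hm : ‖m‖ < 1)
    (hΩ : Bornology.IsBounded Ω) (hΩo : IsOpen Ω) (hv : Integrable v (volume.restrict Ω)) :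
    ContinuousOn (fun x => ∫ y in Ω, greenKernel k m (x - y) * v y) (closure Ω)ᶜ := by
  intro x hx
  refine ContinuousAt.continuousWithinAt ?_
  obtain ⟨δ, R, hδ, hR, h⟩ := exists_dist_bounds hΩ hx
  have hg := continuousOn_greenKernel hd hk hm
  have hK : IsCompact (Metric.closedBall (0 : EuclideanSpace ℝ (Fin d)) (R + δ / 2) ∩
      {z | δ / 2 ≤ ‖z‖}) :=
    (isCompact_closedBall _ _).inter_right (isClosed_le continuous_const continuous_norm)
  obtain ⟨C, hC⟩ := hK.exists_bound_of_continuousOn (hg.mono (by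
    rintro z ⟨-, hz⟩ rfl
    simp only [Set.mem_ofPred_eq, norm_zero] at hz
    linarith))
  have hmem : ∀ x' ∈ Metric.ball x (δ / 2), ∀ y ∈ Ω,
      x' - y ∈ Metric.closedBall (0 : EuclideanSpace ℝ (Fin d)) (R + δ / 2) ∩
      {z | δ / 2 ≤ ‖z‖} := by
    intro x' hx' y hy
    obtain ⟨h1, h2⟩ := h y hy
    rw [Metric.mem_ball, dist_eq_norm] at hx'
    have e : x' - y = (x' - x) + (x - y) := by abel
    have e' : x - y = (x' - y) - (x' - x) := by abel
    constructor
    · rw [mem_closedBall_zero_iff, e]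
      linarith [norm_add_le (x' - x) (x - y)]
    · have := norm_sub_le (x' - y) (x' - x)
      rw [← e'] at this
      simp only [Set.mem_ofPred_eq]
      linarith
  refine continuousAt_of_dominated (bound := fun y => C * ‖v y‖) ?_ ?_ (hv.norm.const_mul C) ?_
  · refine Eventually.of_forall fun x' => ?_
    exact ((measurable_greenKernel k m).comp
      (measurable_const.sub measurable_id)).aestronglyMeasurable.mul hv.1
  · filter_upwards [Metric.ball_mem_nhds x (half_pos hδ)] with x' hx'
    filter_upwards [ae_restrict_mem hΩo.measurableSet] with y hy
    rw [norm_mul]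
    exact mul_le_mul_of_nonneg_right (hC _ (hmem x' hx' y hy)) (norm_nonneg _)
  · filter_upwards [ae_restrict_mem hΩo.measurableSet] with y hy
    have hne : x - y ≠ 0 := by
      rw [← norm_pos_iff]
      exact hδ.trans_le (h y hy).1
    have h1 : ContinuousAt (greenKernel k m) (x - y) :=
      hg.continuousAt (isOpen_compl_singleton.mem_nhds hne)
    have h2 : ContinuousAt (fun x : EuclideanSpace ℝ (Fin d) => x - y) x := by fun_prop
    exact (ContinuousAt.comp (f := fun x : EuclideanSpace ℝ (Fin d) => x - y) h1 h2).mul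
      continuousAt_const

/-- For $x$ at positive distance from $\Omega$, the quadratic form at $x+\tau w-y$ extends to
complex $\tau$ and, for small $\tau$ uniformly in $y\in\Omega$, stays in a compact part of the right
half-plane, where $\Psi$ is holomorphic and bounded. The potential along the line is thus the
restriction of a holomorphic function to the real axis. -/
theorem lineAnalyticOn_potential (hd : d = 2 ∨ d = 3) (hk : 0 < k) (hm : ‖m‖ < 1)
    (hΩ : Bornology.IsBounded Ω) (hΩo : IsOpen Ω) (hv : Integrable v (volume.restrict Ω)) :
    LineAnalyticOn (fun x => ∫ y in Ω, greenKernel k m (x - y) * v y) (closure Ω)ᶜ := by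
  intro x hx w
  obtain ⟨δ, R, hδ, hR, h⟩ := exists_dist_bounds hΩ hx
  obtain ⟨P, C, -, hP⟩ := greenKernel_eq_profile hd hk hm
  have hb := betaSq_pos hm
  have hκ : 0 < k / betaSq m := div_pos hk hb
  set κ := k / betaSq m
  set c := betaSq m * δ ^ 2 with hc
  have hc0 : 0 < c := by positivity
  set W := ‖w‖ with hW
  have hW0 : 0 ≤ W := norm_nonneg w
  -- For $|\tau|<r\le1$ the $\tau$-dependent terms of the form are at most $rD\le c/2$, half the
  -- lower bound $c$ for its value at $\tau=0$. The summand 1 keeps $D$ positive when $w=0$.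
  set D := 2 * R * W + W ^ 2 + 1 with hD
  have hD0 : 0 < D := by positivity
  set r := min 1 (c / (2 * D)) with hr
  have hr0 : 0 < r := by positivity
  have hr1 : r ≤ 1 := min_le_left _ _
  have hrD : r * D ≤ c / 2 := by
    have : r ≤ c / (2 * D) := min_le_right _ _
    calc r * D ≤ c / (2 * D) * D := by gcongr
      _ = c / 2 := by field_simp
  set q : ℂ → EuclideanSpace ℝ (Fin d) → ℂ := fun τ y =>
    (machForm m (x - y) (x - y) : ℂ) + (2 * τ * (machForm m (x - y) w : ℂ) +
      τ ^ 2 * (machForm m w w : ℂ)) with hq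
  have hqb : ∀ τ ∈ Metric.ball (0 : ℂ) r, ∀ y ∈ Ω, c / 2 ≤ (q τ y).re ∧
      ‖q τ y‖ ≤ R ^ 2 + c / 2 := by
    intro τ hτ y hy
    obtain ⟨h1, h2⟩ := h y hy
    rw [mem_ball_zero_iff] at hτ
    have hpert : ‖(2 * τ * (machForm m (x - y) w : ℂ) + τ ^ 2 * (machForm m w w : ℂ))‖ ≤ c / 2 := by
      have b1 : |machForm m (x - y) w| ≤ R * W :=
        (abs_machForm_le hm _ _).trans (by gcongr)
      have b2 : |machForm m w w| ≤ W ^ 2 := (abs_machForm_le hm _ _).trans_eq (sq W).symm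
      refine (norm_add_le _ _).trans ?_
      rw [norm_mul, norm_mul, norm_mul, norm_pow, Complex.norm_real, Complex.norm_real,
        Real.norm_eq_abs, Real.norm_eq_abs, Complex.norm_ofNat]
      calc 2 * ‖τ‖ * |machForm m (x - y) w| + ‖τ‖ ^ 2 * |machForm m w w|
          ≤ 2 * r * (R * W) + r * W ^ 2 := by
            have : ‖τ‖ ^ 2 ≤ r := by nlinarith [norm_nonneg τ]
            gcongr
        _ ≤ r * D := by
            rw [hD]
            nlinarith
        _ ≤ c / 2 := hrD
    have hm1 : c ≤ machForm m (x - y) (x - y) := by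
      refine le_trans ?_ (le_machForm_self _)
      rw [hc]
      gcongr
    have hm2 : |machForm m (x - y) (x - y)| ≤ R ^ 2 := by
      refine (abs_machForm_le hm _ _).trans ?_
      rw [← sq]
      gcongr
    constructor
    · rw [hq]
      simp only [Complex.add_re, Complex.ofReal_re]
      have := (abs_le.1 ((Complex.abs_re_le_norm _).trans hpert)).1
      rw [Complex.add_re] at this
      linarith
    · refine (norm_add_le _ _).trans ?_
      rw [Complex.norm_real, Real.norm_eq_abs]
      linarith
  set L : Set ℂ := Metric.closedBall 0 (κ ^ 2 * (R ^ 2 + c / 2)) ∩ {z | κ ^ 2 * (c / 2) ≤ z.re}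
    with hL
  have hLc : IsCompact L :=
    (isCompact_closedBall _ _).inter_right (isClosed_le continuous_const Complex.continuous_re)
  obtain ⟨N, hN⟩ := hLc.exists_bound_of_continuousOn (P.differentiableOn.continuousOn.mono (by
    rintro z ⟨-, hz⟩
    have : 0 < κ ^ 2 * (c / 2) := by positivity
    exact this.trans_le hz))
  have hqL : ∀ τ ∈ Metric.ball (0 : ℂ) r, ∀ y ∈ Ω, (κ : ℂ) ^ 2 * q τ y ∈ L := by
    intro τ hτ y hy
    obtain ⟨h1, h2⟩ := hqb τ hτ y hy
    constructor
    · rw [mem_closedBall_zero_iff, norm_mul, norm_pow, Complex.norm_real, Real.norm_of_nonneg hκ.le]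
      gcongr
    · rw [Set.mem_ofPred_eq, ← Complex.ofReal_pow, Complex.re_ofReal_mul]
      gcongr
  have hqpos : ∀ τ ∈ Metric.ball (0 : ℂ) r, ∀ y ∈ Ω, 0 < ((κ : ℂ) ^ 2 * q τ y).re := by
    intro τ hτ y hy
    have : 0 < κ ^ 2 * (c / 2) := by positivity
    exact this.trans_le (hqL τ hτ y hy).2
  set ex : ℂ → EuclideanSpace ℝ (Fin d) → ℂ := fun τ y =>
    Complex.exp (-(Complex.I * (κ * ((inner ℝ (x - y) m : ℝ) + τ * (inner ℝ w m : ℝ))))) with hex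
  set F : ℂ → EuclideanSpace ℝ (Fin d) → ℂ := fun τ y =>
    C * ex τ y * P.Ψ ((κ : ℂ) ^ 2 * q τ y) with hF
  have hG : DifferentiableOn ℂ (fun τ => ∫ y in Ω, F τ y * v y) (Metric.ball 0 r) := by
    refine differentiableOn_integral_mul (C := ‖C‖ * Real.exp (κ * W) * N) hv ?_ ?_ ?_
    · intro τ hτ
      refine ContinuousOn.aestronglyMeasurable ?_ hΩo.measurableSet
      refine ContinuousOn.mul (Continuous.continuousOn (by fun_prop)) ?_
      refine P.differentiableOn.continuousOn.comp (t := {z | 0 < z.re}) ?_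
        (fun y hy => hqpos τ hτ y hy)
      have h1 : Continuous fun y => machForm m (x - y) (x - y) :=
        continuous_machForm_self.comp (continuous_const.sub continuous_id)
      have h2 : Continuous fun y => machForm m (x - y) w := by
        unfold machForm
        fun_prop
      exact Continuous.continuousOn (by fun_prop)
    · filter_upwards [ae_restrict_mem hΩo.measurableSet] with y hy
      refine DifferentiableOn.mul (Differentiable.differentiableOn (by fun_prop)) ?_
      refine P.differentiableOn.comp (t := {z | 0 < z.re}) ?_ (fun τ hτ => hqpos τ hτ y hy)
      exact Differentiable.differentiableOn (by fun_prop)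
    · filter_upwards [ae_restrict_mem hΩo.measurableSet] with y hy τ hτ
      have hτ1 : ‖τ‖ ≤ 1 := ((mem_ball_zero_iff.1 hτ).le).trans hr1
      have he : ‖ex τ y‖ ≤ Real.exp (κ * W) := by
        rw [hex, Complex.norm_exp, Real.exp_le_exp]
        have : (-(Complex.I * (κ * ((inner ℝ (x - y) m : ℝ) + τ * (inner ℝ w m : ℝ))))).re =
            κ * (τ.im * inner ℝ w m) := by simp
        rw [this]
        refine mul_le_mul_of_nonneg_left ?_ hκ.le
        refine (le_abs_self _).trans ?_
        rw [abs_mul]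
        have b1 : |τ.im| ≤ 1 := (Complex.abs_im_le_norm τ).trans hτ1
        have b2 : |(inner ℝ w m : ℝ)| ≤ W := by
          refine (abs_real_inner_le_norm w m).trans ?_
          exact mul_le_of_le_one_right hW0 hm.le
        calc |τ.im| * |(inner ℝ w m : ℝ)| ≤ 1 * W := by gcongr
          _ = W := one_mul W
      rw [hF, norm_mul, norm_mul]
      gcongr
      exact hN _ (hqL τ hτ y hy)
  have han : AnalyticAt ℝ (fun τ : ℂ => ∫ y in Ω, F τ y * v y) ((0 : ℝ) : ℂ) := by
    rw [Complex.ofReal_zero]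
    exact (hG.analyticAt (Metric.ball_mem_nhds 0 hr0)).restrictScalars
  have hof : AnalyticAt ℝ (fun s : ℝ => (s : ℂ)) 0 := Complex.ofRealCLM.analyticAt 0
  refine (han.comp_of_eq hof rfl).congr ?_
  filter_upwards [Metric.ball_mem_nhds (0 : ℝ) hr0] with s hs
  refine setIntegral_congr_fun hΩo.measurableSet fun y hy => ?_
  have hs' : (s : ℂ) ∈ Metric.ball (0 : ℂ) r := by
    rw [mem_ball_zero_iff, Complex.norm_real]
    exact mem_ball_zero_iff.1 hs
  have hqs : q s y = ((machForm m (x + s • w - y) (x + s • w - y) : ℝ) : ℂ) := by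
    have e : x + s • w - y = (x - y) + s • w := by abel
    rw [e, machForm_add_left, machForm_add_right, machForm_add_right, machForm_smul_left,
      machForm_smul_left, machForm_smul_right, machForm_smul_right, machForm_comm w (x - y), hq]
    push_cast
    ring
  have hne : x + s • w - y ≠ 0 := by
    intro h0
    have := hqpos s hs' y hy
    rw [hqs, h0] at this
    simp [machForm] at this
  have e : x + s • w - y = (x - y) + s • w := by abel
  simp only [hF]
  rw [hP _ hne, mul_pow, machNorm_sq hm, hqs, hex, e, inner_add_left, real_inner_smul_left]
  push_cast
  rfl

end Potential

/-! ### From a vanishing exterior potential to orthogonality to plane waves -/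

section FarField

theorem tendsto_sqrt_quadratic_div (b c : ℝ) :
    Tendsto (fun t : ℝ => Real.sqrt (t ^ 2 - 2 * t * b + c) / t) atTop (𝓝 1) := by
  have h1 : Tendsto (fun t : ℝ => Real.sqrt (1 - 2 * b * t⁻¹ + c * (t⁻¹ * t⁻¹))) atTop
      (𝓝 (Real.sqrt (1 - 2 * b * 0 + c * (0 * 0)))) := by
    have hi : Tendsto (fun t : ℝ => t⁻¹) atTop (𝓝 0) := tendsto_inv_atTop_zero
    exact (Real.continuous_sqrt.tendsto _).comp
      (((hi.const_mul (2 * b)).const_sub 1).add ((hi.mul hi).const_mul c))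
  simp only [mul_zero, sub_zero, add_zero, Real.sqrt_one] at h1
  refine h1.congr' ?_
  filter_upwards [eventually_gt_atTop 0] with t ht
  have e : Real.sqrt (t ^ 2 - 2 * t * b + c) / t =
      Real.sqrt (t ^ 2 - 2 * t * b + c) / Real.sqrt (t ^ 2) := by rw [Real.sqrt_sq ht.le]
  rw [e, ← Real.sqrt_div' _ (by positivity)]
  congr 1
  field_simp

/-- Rationalize: the difference equals $(-2b+c/t)/(\sqrt{t^2-2tb+c}/t+1)$, and the previous limit
handles the denominator. With $t^2-2tb+c=|t\omega-y|_{\mathbf m}^2$ this is the far-field expansion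
of the distance. -/
theorem tendsto_sqrt_quadratic_sub (b c : ℝ) :
    Tendsto (fun t : ℝ => Real.sqrt (t ^ 2 - 2 * t * b + c) - t) atTop (𝓝 (-b)) := by
  have h1 := tendsto_sqrt_quadratic_div b c
  have h2 : Tendsto (fun t : ℝ => (-2 * b + c * t⁻¹) /
      (Real.sqrt (t ^ 2 - 2 * t * b + c) / t + 1)) atTop (𝓝 ((-2 * b + c * 0) / (1 + 1))) :=
    ((tendsto_inv_atTop_zero.const_mul c).const_add (-2 * b)).div (h1.add_const 1) (by norm_num)
  have e : (-2 * b + c * 0) / (1 + 1) = -b := by ring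
  rw [e] at h2
  refine h2.congr' ?_
  filter_upwards [eventually_gt_atTop 0, h1.eventually (lt_mem_nhds (zero_lt_one))] with t ht hpos
  have hs : 0 < Real.sqrt (t ^ 2 - 2 * t * b + c) := by
    by_contra hcon
    exact absurd hpos (not_lt.2 (div_nonpos_of_nonpos_of_nonneg (not_lt.1 hcon) ht.le))
  have hsq := Real.sq_sqrt (Real.sqrt_pos.1 hs).le
  generalize Real.sqrt (t ^ 2 - 2 * t * b + c) = s at *
  rw [div_eq_iff (by positivity)]
  field_simp
  nlinarith

theorem tendsto_sqrt_quadratic_atTop (b c : ℝ) :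
    Tendsto (fun t : ℝ => Real.sqrt (t ^ 2 - 2 * t * b + c)) atTop atTop := by
  have := (tendsto_sqrt_quadratic_sub b c).add_atTop tendsto_id
  simpa using this

theorem OscillatingProfile.exists_bound (P : OscillatingProfile) : ∃ R N : ℝ, 0 < R ∧ 0 ≤ N ∧
    ∀ r : ℝ, R ≤ r → ‖((r ^ P.p : ℝ) : ℂ) * P.Ψ ((r ^ 2 : ℝ) : ℂ)‖ ≤ N := by
  have h := P.tendsto.norm.eventually (gt_mem_nhds (show ‖(0 : ℂ)‖ < 1 by simp))
  obtain ⟨R, hR⟩ := eventually_atTop.1 h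
  refine ⟨max R 1, 1 + (‖P.a‖ + ‖P.b‖), by positivity, by positivity, fun r hr => ?_⟩
  have h1 := hR r ((le_max_left _ _).trans hr)
  have h2 : ‖P.a * Complex.exp (r * Complex.I) + P.b * Complex.exp (-(r * Complex.I))‖ ≤
      ‖P.a‖ + ‖P.b‖ := by
    refine (norm_add_le _ _).trans ?_
    have e : -((r : ℂ) * Complex.I) = ((-r : ℝ) : ℂ) * Complex.I := by push_cast; ring
    rw [norm_mul, norm_mul, e, Complex.norm_exp_ofReal_mul_I, Complex.norm_exp_ofReal_mul_I,
      mul_one, mul_one]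
  have := norm_sub_norm_le (((r ^ P.p : ℝ) : ℂ) * P.Ψ ((r ^ 2 : ℝ) : ℂ))
    (P.a * Complex.exp (r * Complex.I) + P.b * Complex.exp (-(r * Complex.I)))
  linarith

/-- Along a sequence with $\kappa T_n\equiv\theta$ modulo $2\pi$ the oscillating factors converge:
$\kappa|T_n\omega-y|_{\mathbf m}$ is asymptotically $\kappa T_n-\kappa b$, so only the phases
$\theta$ and $\kappa b$ survive. The free parameter $\theta$ later separates the $a$ and $b$ parts.
-/
theorem OscillatingProfile.tendsto_shifted (P : OscillatingProfile) {κ : ℝ} (hκ : 0 < κ) (θ b c : ℝ)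
    {T : ℕ → ℝ} (hT : ∀ n : ℕ, κ * T n = θ + n * (2 * Real.pi)) (hTt : Tendsto T atTop atTop) :
    Tendsto (fun n => (((κ * T n) ^ P.p : ℝ) : ℂ) *
      P.Ψ (((κ * Real.sqrt (T n ^ 2 - 2 * T n * b + c)) ^ 2 : ℝ) : ℂ)) atTop
      (𝓝 (P.a * Complex.exp (Complex.I * θ) * Complex.exp (-(Complex.I * (κ * b : ℝ))) +
        P.b * Complex.exp (-(Complex.I * θ)) * Complex.exp (Complex.I * (κ * b : ℝ)))) := by
  set s : ℕ → ℝ := fun n => Real.sqrt (T n ^ 2 - 2 * T n * b + c) with hs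
  have hst : Tendsto (fun n => κ * s n) atTop atTop :=
    ((tendsto_sqrt_quadratic_atTop b c).comp hTt).const_mul_atTop hκ
  have hsub : Tendsto (fun n => κ * (s n - T n)) atTop (𝓝 (κ * -b)) :=
    ((tendsto_sqrt_quadratic_sub b c).comp hTt).const_mul κ
  have hratio : Tendsto (fun n => ((s n / T n)⁻¹ ^ P.p : ℝ)) atTop (𝓝 1) := by
    have h1 := ((tendsto_sqrt_quadratic_div b c).comp hTt).inv₀ one_ne_zero
    rw [inv_one] at h1
    have := h1.rpow_const (p := P.p) (Or.inl one_ne_zero)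
    rwa [Real.one_rpow] at this
  have hper : ∀ (σ : ℂ) (_ : σ = 1 ∨ σ = -1) (n : ℕ),
      Complex.exp (σ * ((κ * s n : ℝ) * Complex.I)) =
      Complex.exp (σ * (Complex.I * θ)) * Complex.exp (σ * ((κ * (s n - T n) : ℝ) * Complex.I)) := by
    intro σ hσ n
    have e : σ * ((κ * s n : ℝ) * Complex.I) = σ * (Complex.I * θ) +
        σ * ((κ * (s n - T n) : ℝ) * Complex.I) + σ * (n * (2 * Real.pi * Complex.I)) := by
      have h2 : ((κ * s n : ℝ) : ℂ) = ((κ * (s n - T n) : ℝ) : ℂ) + (θ + n * (2 * Real.pi)) := by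
        have : κ * s n = κ * (s n - T n) + (θ + n * (2 * Real.pi)) := by rw [← hT n]; ring
        rw [this]
        push_cast
        ring
      rw [h2]
      ring
    rw [e, Complex.exp_add, Complex.exp_add]
    have : Complex.exp (σ * (n * (2 * Real.pi * Complex.I))) = 1 := by
      rcases hσ with rfl | rfl
      · rw [one_mul, Complex.exp_nat_mul_two_pi_mul_I]
      · rw [neg_one_mul, Complex.exp_neg, Complex.exp_nat_mul_two_pi_mul_I, inv_one]
    rw [this, mul_one]
  have hosc : Tendsto (fun n => P.a * Complex.exp ((κ * s n : ℝ) * Complex.I) +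
      P.b * Complex.exp (-((κ * s n : ℝ) * Complex.I))) atTop
      (𝓝 (P.a * (Complex.exp (Complex.I * θ) * Complex.exp (-(Complex.I * (κ * b : ℝ)))) +
        P.b * (Complex.exp (-(Complex.I * θ)) * Complex.exp (Complex.I * (κ * b : ℝ))))) := by
    have hlim : ∀ σ : ℂ, Tendsto
        (fun n => Complex.exp (σ * ((κ * (s n - T n) : ℝ) * Complex.I))) atTop
        (𝓝 (Complex.exp (σ * ((κ * -b : ℝ) * Complex.I)))) := by
      intro σ
      have hc : Continuous fun x : ℝ => Complex.exp (σ * ((x : ℂ) * Complex.I)) := by fun_prop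
      exact (hc.tendsto _).comp hsub
    have e1 : ∀ n, Complex.exp ((κ * s n : ℝ) * Complex.I) = Complex.exp (Complex.I * θ) *
        Complex.exp (1 * ((κ * (s n - T n) : ℝ) * Complex.I)) := by
      intro n
      simpa only [one_mul] using hper 1 (Or.inl rfl) n
    have e2 : ∀ n, Complex.exp (-((κ * s n : ℝ) * Complex.I)) = Complex.exp (-(Complex.I * θ)) *
        Complex.exp (-1 * ((κ * (s n - T n) : ℝ) * Complex.I)) := by
      intro n
      simpa only [neg_one_mul] using hper (-1) (Or.inr rfl) n
    have f1 : -(Complex.I * ((κ * b : ℝ) : ℂ)) = 1 * (((κ * -b : ℝ) : ℂ) * Complex.I) := by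
      push_cast
      ring
    have f2 : Complex.I * ((κ * b : ℝ) : ℂ) = -1 * (((κ * -b : ℝ) : ℂ) * Complex.I) := by
      push_cast
      ring
    simp only [e1, e2]
    rw [f1, f2]
    exact (((hlim 1).const_mul _).const_mul _).add (((hlim (-1)).const_mul _).const_mul _)
  have hmain := ((P.tendsto.comp hst).add hosc)
  simp only [Function.comp_def, sub_add_cancel, zero_add, ← mul_assoc] at hmain
  have := ((Complex.continuous_ofReal.tendsto _).comp hratio).mul hmain
  simp only [Complex.ofReal_one, one_mul] at this
  refine this.congr' ?_
  filter_upwards [hst.eventually_gt_atTop 0, hTt.eventually_gt_atTop 0] with n hn hTn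
  have hsn : 0 < s n := (mul_pos_iff_of_pos_left hκ).1 hn
  simp only [Function.comp_apply, ← mul_assoc, ← Complex.ofReal_mul]
  congr 2
  rw [← Real.mul_rpow (by positivity) hn.le]
  congr 1
  field_simp

variable {d : ℕ} {k : ℝ} {m : EuclideanSpace ℝ (Fin d)} {Ω : Set (EuclideanSpace ℝ (Fin d))}

/-- If a volume potential vanishes outside the support of its density, the density is orthogonal to
all plane waves of one family. The sign `σ` is the sign in the radiation condition. -/
theorem exists_integral_planeWave_eq_zero (hd : d = 2 ∨ d = 3) (hk : 0 < k) (hm : ‖m‖ < 1)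
    (hΩ : Bornology.IsBounded Ω) (hΩo : IsOpen Ω) :
    ∃ σ : ℝ, σ ≠ 0 ∧ ∀ v : EuclideanSpace ℝ (Fin d) → ℂ, Integrable v (volume.restrict Ω) →
      (∀ x ∈ (closure Ω)ᶜ, ∫ y in Ω, greenKernel k m (x - y) * v y = 0) →
      ∀ ω : EuclideanSpace ℝ (Fin d), machForm m ω ω = 1 →
        ∫ y in Ω, Complex.exp (Complex.I *
          ((k / betaSq m * (inner ℝ y m - σ * machForm m ω y) : ℝ) : ℂ)) * v y = 0 := by
  obtain ⟨P, C, hC, hP⟩ := greenKernel_eq_profile hd hk hm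
  have hκ : 0 < k / betaSq m := div_pos hk (betaSq_pos hm)
  set κ := k / betaSq m
  obtain ⟨ρ', hρ'⟩ := hΩ.exists_norm_le
  set ρ := max ρ' 0
  have hρ0 : 0 ≤ ρ := le_max_right _ _
  have hρ : ∀ y ∈ closure Ω, ‖y‖ ≤ ρ := by
    have : Ω ⊆ Metric.closedBall 0 ρ := fun y hy => by
      rw [mem_closedBall_zero_iff]
      exact (hρ' y hy).trans (le_max_left _ _)
    exact fun y hy => mem_closedBall_zero_iff.1 (closure_minimal this Metric.isClosed_closedBall hy)
  have key : ∀ v : EuclideanSpace ℝ (Fin d) → ℂ, Integrable v (volume.restrict Ω) →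
      (∀ x ∈ (closure Ω)ᶜ, ∫ y in Ω, greenKernel k m (x - y) * v y = 0) →
      ∀ ω : EuclideanSpace ℝ (Fin d), machForm m ω ω = 1 → ∀ θ : ℝ,
      P.a * Complex.exp (Complex.I * θ) * (∫ y in Ω, Complex.exp (Complex.I *
          ((κ * (inner ℝ y m - 1 * machForm m ω y) : ℝ) : ℂ)) * v y) +
      P.b * Complex.exp (-(Complex.I * θ)) * (∫ y in Ω, Complex.exp (Complex.I *
          ((κ * (inner ℝ y m - (-1) * machForm m ω y) : ℝ) : ℂ)) * v y) = 0 := by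
    intro v hv hpot ω hω θ
    set T : ℕ → ℝ := fun n => (θ + n * (2 * Real.pi)) / κ with hTdef
    have hT : ∀ n : ℕ, κ * T n = θ + n * (2 * Real.pi) := fun n => mul_div_cancel₀ _ hκ.ne'
    have hTt : Tendsto T atTop atTop :=
      (tendsto_atTop_add_const_left _ _
        (tendsto_natCast_atTop_atTop.atTop_mul_const Real.two_pi_pos)).atTop_div_const hκ
    have hform : ∀ (t : ℝ) (y : EuclideanSpace ℝ (Fin d)), machForm m (t • ω - y) (t • ω - y) =
        t ^ 2 - 2 * t * machForm m ω y + machForm m y y := by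
      intro t y
      rw [machForm_sub_left, machForm_sub_right, machForm_sub_right, machForm_smul_left,
        machForm_smul_left, machForm_smul_right, machForm_smul_right, hω, machForm_comm y ω]
      ring
    set S : ℝ → EuclideanSpace ℝ (Fin d) → ℝ := fun t y =>
      Real.sqrt (t ^ 2 - 2 * t * machForm m ω y + machForm m y y) with hS
    have hSN : ∀ t y, machNorm m (t • ω - y) = S t y := by
      intro t y
      rw [machNorm_eq_sqrt, hform]
    have hω0 : ω ≠ 0 := by
      rintro rfl
      simp [machForm] at hω
    -- The integrand of the potential at $T_n\omega$, rescaled by $(\kappa T_n)^p$ and stripped of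
    -- $C$ and of the $y$-independent flow phase.
    set F : ℕ → EuclideanSpace ℝ (Fin d) → ℂ := fun n y =>
      Complex.exp (Complex.I * (κ * (inner ℝ y m : ℝ) : ℝ)) * ((((κ * T n) ^ P.p : ℝ) : ℂ) *
        P.Ψ (((κ * S (T n) y) ^ 2 : ℝ) : ℂ)) * v y with hF
    have hout : ∀ᶠ n in atTop, T n • ω ∈ (closure Ω)ᶜ := by
      filter_upwards [hTt.eventually_gt_atTop (ρ / ‖ω‖), hTt.eventually_gt_atTop 0] with n hn hn0 hcl
      have := hρ _ hcl
      rw [norm_smul, Real.norm_of_nonneg hn0.le] at this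
      rw [div_lt_iff₀ (norm_pos_iff.2 hω0)] at hn
      linarith
    have hker : ∀ n, T n • ω ∈ (closure Ω)ᶜ → ∀ y ∈ Ω, F n y =
        (Complex.exp (Complex.I * (κ * (inner ℝ (T n • ω) m : ℝ) : ℝ)) * C⁻¹ *
          (((κ * T n) ^ P.p : ℝ) : ℂ)) * (greenKernel k m (T n • ω - y) * v y) := by
      intro n hn y hy
      have hne : T n • ω - y ≠ 0 := by
        intro h0
        rw [sub_eq_zero] at h0
        exact hn (h0 ▸ subset_closure hy)
      have hexp : Complex.exp (Complex.I * (κ * (inner ℝ y m : ℝ) : ℝ)) =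
          Complex.exp (Complex.I * (κ * (inner ℝ (T n • ω) m : ℝ) : ℝ)) *
          Complex.exp (-(Complex.I * ((κ * inner ℝ (T n • ω - y) m : ℝ) : ℂ))) := by
        rw [← Complex.exp_add, inner_sub_left]
        congr 1
        push_cast
        ring
      rw [hP _ hne, hSN, hF]
      simp only
      rw [hexp]
      field_simp
    have hzero : ∀ᶠ n in atTop, ∫ y in Ω, F n y = 0 := by
      filter_upwards [hout] with n hn
      rw [setIntegral_congr_fun hΩo.measurableSet (fun y hy => hker n hn y hy),
        integral_const_mul, hpot _ hn, mul_zero]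
    obtain ⟨R, N, hR, hN, hRN⟩ := P.exists_bound
    -- For $T_n\ge4|\omega|\rho$ the form satisfies $T_n^2-2T_nb+c\ge T_n^2/2$, hence
    -- $|T_n\omega-y|_{\mathbf m}\ge T_n/2$; replacing $T_n$ by this distance in the rescaling costs
    -- the factor $2^p$.
    have hdom : ∀ᶠ n in atTop, ∀ᵐ y ∂(volume.restrict Ω), ‖F n y‖ ≤ 2 ^ P.p * N * ‖v y‖ := by
      filter_upwards [hTt.eventually_ge_atTop (4 * (‖ω‖ * ρ)), hTt.eventually_gt_atTop 0,
        hTt.eventually_ge_atTop (2 * R / κ)] with n h1 h2 h3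
      filter_upwards [ae_restrict_mem hΩo.measurableSet] with y hy
      have hb : |machForm m ω y| ≤ ‖ω‖ * ρ := by
        refine (abs_machForm_le hm _ _).trans ?_
        gcongr
        exact hρ y (subset_closure hy)
      have hS2 : T n / 2 ≤ S (T n) y := by
        refine Real.le_sqrt_of_sq_le ?_
        have hc := machForm_self_nonneg hm y
        have h4 : 4 * machForm m ω y ≤ T n := by linarith [(abs_le.1 hb).2]
        nlinarith
      have hS0 : 0 < S (T n) y := (half_pos h2).trans_le hS2
      have hRS : R ≤ κ * S (T n) y := by
        rw [div_le_iff₀ hκ] at h3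
        nlinarith
      have hexp : ‖Complex.exp (Complex.I * (κ * (inner ℝ y m : ℝ) : ℝ))‖ = 1 := by
        rw [mul_comm]
        exact Complex.norm_exp_ofReal_mul_I _
      have hpow : (κ * T n) ^ P.p ≤ 2 ^ P.p * (κ * S (T n) y) ^ P.p := by
        rw [← Real.mul_rpow (by norm_num) (by positivity)]
        refine Real.rpow_le_rpow (by positivity) ?_ P.p_nonneg
        nlinarith
      have hbd := hRN _ hRS
      rw [norm_mul, Complex.norm_real, Real.norm_of_nonneg (by positivity)] at hbd
      rw [hF, norm_mul, norm_mul, hexp, one_mul, norm_mul, Complex.norm_real,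
        Real.norm_of_nonneg (by positivity)]
      refine mul_le_mul_of_nonneg_right ?_ (norm_nonneg _)
      calc (κ * T n) ^ P.p * ‖P.Ψ (((κ * S (T n) y) ^ 2 : ℝ) : ℂ)‖
          ≤ 2 ^ P.p * (κ * S (T n) y) ^ P.p * ‖P.Ψ (((κ * S (T n) y) ^ 2 : ℝ) : ℂ)‖ := by gcongr
        _ = 2 ^ P.p * ((κ * S (T n) y) ^ P.p * ‖P.Ψ (((κ * S (T n) y) ^ 2 : ℝ) : ℂ)‖) := by ring
        _ ≤ 2 ^ P.p * N := by gcongr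
    have hmeas : ∀ᶠ n in atTop, AEStronglyMeasurable (F n) (volume.restrict Ω) := by
      filter_upwards [hout] with n hn
      have h1 : AEStronglyMeasurable (fun y => (Complex.exp (Complex.I *
          (κ * (inner ℝ (T n • ω) m : ℝ) : ℝ)) * C⁻¹ * (((κ * T n) ^ P.p : ℝ) : ℂ)) *
          (greenKernel k m (T n • ω - y) * v y)) (volume.restrict Ω) :=
        (((measurable_greenKernel k m).comp
          (measurable_const.sub measurable_id)).aestronglyMeasurable.mul hv.1).const_mul _
      refine h1.congr ?_
      filter_upwards [ae_restrict_mem hΩo.measurableSet] with y hy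
      exact (hker n hn y hy).symm
    set f₁ : EuclideanSpace ℝ (Fin d) → ℂ := fun y => Complex.exp (Complex.I *
          ((κ * (inner ℝ y m - 1 * machForm m ω y) : ℝ) : ℂ)) * v y with hf₁
    set f₂ : EuclideanSpace ℝ (Fin d) → ℂ := fun y => Complex.exp (Complex.I *
          ((κ * (inner ℝ y m - (-1) * machForm m ω y) : ℝ) : ℂ)) * v y with hf₂
    have hint : ∀ σ : ℝ, Integrable (fun y => Complex.exp (Complex.I *
          ((κ * (inner ℝ y m - σ * machForm m ω y) : ℝ) : ℂ)) * v y) (volume.restrict Ω) := by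
      intro σ
      refine hv.bdd_mul (c := 1) ?_ (Eventually.of_forall fun y => ?_)
      · refine Continuous.aestronglyMeasurable ?_
        unfold machForm
        fun_prop
      · rw [mul_comm, Complex.norm_exp_ofReal_mul_I]
    have hlim := tendsto_integral_filter_of_dominated_convergence
      (bound := fun y => 2 ^ P.p * N * ‖v y‖) (μ := volume.restrict Ω) (l := atTop) (F := F)
      (f := fun y => P.a * Complex.exp (Complex.I * θ) * f₁ y +
        P.b * Complex.exp (-(Complex.I * θ)) * f₂ y) hmeas hdom (hv.norm.const_mul _) ?_
    · rw [integral_add ((hint 1).const_mul _) ((hint (-1)).const_mul _), integral_const_mul,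
        integral_const_mul] at hlim
      exact tendsto_nhds_unique hlim
        ((tendsto_const_nhds (x := (0 : ℂ))).congr' (hzero.mono fun n hn => hn.symm))
    · refine Eventually.of_forall fun y => ?_
      have h1 := P.tendsto_shifted hκ θ (machForm m ω y) (machForm m y y) hT hTt
      have h2 := (h1.const_mul (Complex.exp (Complex.I * (κ * (inner ℝ y m : ℝ) : ℝ)))).mul_const
        (v y)
      convert! h2 using 2
      have e1 : Complex.exp (Complex.I * ((κ * (inner ℝ y m - 1 * machForm m ω y) : ℝ) : ℂ)) =
          Complex.exp (Complex.I * (κ * (inner ℝ y m : ℝ) : ℝ)) *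
            Complex.exp (-(Complex.I * (κ * machForm m ω y : ℝ))) := by
        rw [← Complex.exp_add]
        congr 1
        push_cast
        ring
      have e2 : Complex.exp (Complex.I * ((κ * (inner ℝ y m - (-1) * machForm m ω y) : ℝ) : ℂ)) =
          Complex.exp (Complex.I * (κ * (inner ℝ y m : ℝ) : ℝ)) *
            Complex.exp (Complex.I * (κ * machForm m ω y : ℝ)) := by
        rw [← Complex.exp_add]
        congr 1
        push_cast
        ring
      rw [hf₁, hf₂]
      simp only
      rw [e1, e2]
      ring
  -- The values $\theta=0$ and $\theta=\pi/2$ give $aI_1+bI_2=0$ and $aI_1-bI_2=0$.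
  have hsep : ∀ I₁ I₂ : ℂ, (∀ θ : ℝ, P.a * Complex.exp (Complex.I * θ) * I₁ +
      P.b * Complex.exp (-(Complex.I * θ)) * I₂ = 0) → P.a * I₁ = 0 ∧ P.b * I₂ = 0 := by
    intro I₁ I₂ h
    have h0 := h 0
    have h1 := h (Real.pi / 2)
    have e1 : Complex.exp (Complex.I * ((Real.pi / 2 : ℝ) : ℂ)) = Complex.I := by
      rw [mul_comm]
      push_cast
      exact Complex.exp_pi_div_two_mul_I
    rw [Complex.exp_neg, e1, Complex.inv_I] at h1
    simp only [Complex.ofReal_zero, mul_zero, neg_zero, Complex.exp_zero, mul_one] at h0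
    have h2 : P.a * I₁ - P.b * I₂ = 0 := by
      linear_combination (-Complex.I) * h1 + (P.a * I₁ - P.b * I₂) * (Complex.I_sq)
    exact ⟨by linear_combination (h0 + h2) / 2, by linear_combination (h0 - h2) / 2⟩
  -- The sign is dictated by the profile alone, hence is the same for all densities and directions;
  -- products of two plane waves rely on this.
  rcases P.coeff_ne_zero with ha | hb
  · refine ⟨1, one_ne_zero, fun v hv hpot ω hω => ?_⟩
    exact (mul_eq_zero.1 (hsep _ _ (key v hv hpot ω hω)).1).resolve_left ha
  · refine ⟨-1, by norm_num, fun v hv hpot ω hω => ?_⟩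
    exact (mul_eq_zero.1 (hsep _ _ (key v hv hpot ω hω)).2).resolve_left hb

end FarField

/-! ### Injectivity of the Fourier transform on $L^1$ -/

section FourierInjectivity

-- Every smooth compactly supported $g$ is the Fourier transform of a Schwartz function $\psi$, so
-- $\int gf=\int\hat\psi f=\int\psi\hat f=0$; such $g$ detect $f$.
open FourierTransform in
theorem ae_eq_zero_of_forall_integral_exp_inner {V : Type*} [NormedAddCommGroup V]
    [InnerProductSpace ℝ V] [FiniteDimensional ℝ V] [MeasurableSpace V] [BorelSpace V] {f : V → ℂ}
    (hf : Integrable f)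
    (h : ∀ ξ : V, ∫ y, Complex.exp (Complex.I * (inner ℝ ξ y : ℝ)) * f y = 0) : f =ᵐ[volume] 0 := by
  have hF : ∀ w, VectorFourier.fourierIntegral Real.fourierChar volume (innerₗ V) f w = 0 := by
    intro w
    have e : VectorFourier.fourierIntegral Real.fourierChar volume (innerₗ V) f w = 𝓕 f w := rfl
    rw [e, Real.fourier_eq', ← h ((-2 * Real.pi) • w)]
    refine integral_congr_ae (Eventually.of_forall fun y => ?_)
    simp only [smul_eq_mul, real_inner_smul_left, real_inner_comm w y]
    congr 2
    push_cast
    ring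
  refine ae_eq_zero_of_integral_contDiff_smul_eq_zero hf.locallyIntegrable fun g hg hgc => ?_
  have hgc' : HasCompactSupport fun y => (g y : ℂ) := hgc.comp_left Complex.ofReal_zero
  set φ : SchwartzMap V ℂ := hgc'.toSchwartzMap (Complex.ofRealCLM.contDiff.comp hg)
  have hφ : ∀ y, 𝓕 (𝓕⁻ φ : SchwartzMap V ℂ) y = (g y : ℂ) := by
    intro y
    rw [FourierTransform.fourier_fourierInv_eq]
    rfl
  have key := VectorFourier.integral_fourierIntegral_smul_eq_flip (μ := volume) (ν := volume)
    (L := innerₗ V) (f := f) (g := (𝓕⁻ φ : SchwartzMap V ℂ)) Real.continuous_fourierChar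
    continuous_inner hf (SchwartzMap.integrable _)
  simp only [hF, zero_smul, integral_zero] at key
  rw [key]
  refine integral_congr_ae (Eventually.of_forall fun y => ?_)
  have e : VectorFourier.fourierIntegral Real.fourierChar volume (innerₗ V).flip
      (𝓕⁻ φ : SchwartzMap V ℂ) y = 𝓕 (𝓕⁻ φ : SchwartzMap V ℂ) y := by
    rw [flip_innerₗ]
    rfl
  simp only [e, hφ, smul_eq_mul, Complex.real_smul, mul_comm]

end FourierInjectivity

/-! ### Unit vectors and duality for the Mach form -/

section FormGeometry

variable {d : ℕ} {m : EuclideanSpace ℝ (Fin d)}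

theorem exists_machForm_unit_orthogonal (hd : d = 2 ∨ d = 3) (hm : ‖m‖ < 1)
    (η : EuclideanSpace ℝ (Fin d)) : ∃ e, machForm m e e = 1 ∧ machForm m η e = 0 := by
  set L : EuclideanSpace ℝ (Fin d) →ₗ[ℝ] ℝ :=
    { toFun := machForm m η
      map_add' := machForm_add_right η
      map_smul' := fun s z => machForm_smul_right s η z } with hL
  have hker : LinearMap.ker L ≠ ⊥ := LinearMap.ker_ne_bot_of_finrank_lt (by
    rw [Module.finrank_self, finrank_euclideanSpace_fin]
    omega)
  obtain ⟨e, he, he0⟩ := Submodule.exists_mem_ne_zero_of_ne_bot hker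
  have hpos := machForm_self_pos hm he0
  have he' : machForm m η e = 0 := he
  refine ⟨(Real.sqrt (machForm m e e))⁻¹ • e, ?_, ?_⟩
  · rw [machForm_smul_left, machForm_smul_right, ← mul_assoc, ← mul_inv,
      Real.mul_self_sqrt hpos.le, inv_mul_cancel₀ hpos.ne']
  · rw [machForm_smul_right, he', mul_zero]

/-- Differences of unit vectors fill the ball of radius two. -/
theorem exists_sub_eq_of_machForm_le (hd : d = 2 ∨ d = 3) (hm : ‖m‖ < 1)
    {η : EuclideanSpace ℝ (Fin d)} (hη : machForm m η η ≤ 4) :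
    ∃ ω ω', machForm m ω ω = 1 ∧ machForm m ω' ω' = 1 ∧ ω - ω' = η := by
  obtain ⟨e, he, hηe⟩ := exists_machForm_unit_orthogonal hd hm η
  have hc := Real.mul_self_sqrt (show 0 ≤ 1 - machForm m η η / 4 by linarith)
  set c := Real.sqrt (1 - machForm m η η / 4)
  -- With $e$ a unit vector orthogonal to $\eta$, Pythagoras makes $\pm\frac12\eta+ce$ unit vectors;
  -- their difference is $\eta$.
  have hkey : ∀ s : ℝ, s * s = 1 / 4 → machForm m (s • η + c • e) (s • η + c • e) = 1 := by
    intro s hs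
    simp only [machForm_add_left, machForm_add_right, machForm_smul_left, machForm_smul_right,
      machForm_comm e η, hηe, he]
    linear_combination hc + machForm m η η * hs
  refine ⟨(1 / 2 : ℝ) • η + c • e, (-(1 / 2) : ℝ) • η + c • e, hkey _ (by norm_num),
    hkey _ (by norm_num), ?_⟩
  module

theorem exists_machForm_eq_inner (hm : ‖m‖ < 1) (ξ : EuclideanSpace ℝ (Fin d)) :
    ∃ η, ∀ y, machForm m η y = inner ℝ ξ y := by
  have hb := (betaSq_pos hm).ne'
  -- The form has matrix $\beta^2I+\mathbf m\mathbf m^T$, with inverse $\beta^{-2}(I-\mathbf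
  -- m\mathbf m^T)$ because $\beta^2+|\mathbf m|^2=1$.
  refine ⟨(betaSq m)⁻¹ • (ξ - (inner ℝ ξ m : ℝ) • m), fun y => ?_⟩
  simp only [machForm, real_inner_smul_left, inner_sub_left, real_inner_self_eq_norm_sq,
    real_inner_comm y m]
  field_simp
  rw [betaSq]
  ring

end FormGeometry

/-! ### Densities on a bounded set with Fourier transform vanishing near the origin -/

section FourierOfBounded

variable {d : ℕ} {m : EuclideanSpace ℝ (Fin d)} {Ω : Set (EuclideanSpace ℝ (Fin d))}
  {q : EuclideanSpace ℝ (Fin d) → ℂ}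

/-- Boundedness of $\Omega$ bounds the exponential for complex displacements of $\eta$, so the
transform is holomorphic along complexified lines. -/
theorem lineAnalyticOn_integral_exp_machForm (hm : ‖m‖ < 1) (hΩ : Bornology.IsBounded Ω)
    (hΩo : IsOpen Ω) (hq : Integrable q (volume.restrict Ω)) (τ : ℝ) :
    LineAnalyticOn (fun η => ∫ y in Ω, Complex.exp (Complex.I * (τ * machForm m η y : ℝ)) * q y)
      Set.univ := by
  intro x _ w
  obtain ⟨ρ, hρ⟩ := hΩ.exists_norm_le
  set F : ℂ → EuclideanSpace ℝ (Fin d) → ℂ := fun z y =>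
    Complex.exp (Complex.I * (τ * ((machForm m x y : ℝ) + z * (machForm m w y : ℝ)))) with hF
  have hcont : ∀ u : EuclideanSpace ℝ (Fin d), Continuous fun y => machForm m u y := by
    intro u
    unfold machForm
    fun_prop
  have hG : DifferentiableOn ℂ (fun z => ∫ y in Ω, F z y * q y) (Metric.ball 0 1) := by
    refine differentiableOn_integral_mul (C := Real.exp (|τ| * (‖w‖ * ρ))) hq ?_ ?_ ?_
    · intro z _
      have h1 := hcont x
      have h2 := hcont w
      exact Continuous.aestronglyMeasurable (by fun_prop)
    · exact Eventually.of_forall fun y => Differentiable.differentiableOn (by fun_prop)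
    · filter_upwards [ae_restrict_mem hΩo.measurableSet] with y hy z hz
      rw [hF, Complex.norm_exp, Real.exp_le_exp]
      have e : (Complex.I * (τ * ((machForm m x y : ℝ) + z * (machForm m w y : ℝ)))).re =
          -(τ * (z.im * machForm m w y)) := by simp
      rw [e]
      refine (neg_le_abs _).trans ?_
      rw [abs_mul, abs_mul]
      have hz1 : |z.im| ≤ 1 := (Complex.abs_im_le_norm z).trans (mem_ball_zero_iff.1 hz).le
      have hw : |machForm m w y| ≤ ‖w‖ * ρ :=
        (abs_machForm_le hm w y).trans (by gcongr; exact hρ y hy)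
      calc |τ| * (|z.im| * |machForm m w y|) ≤ |τ| * (1 * (‖w‖ * ρ)) := by gcongr
        _ = _ := by rw [one_mul]
  have han : AnalyticAt ℝ (fun z : ℂ => ∫ y in Ω, F z y * q y) ((0 : ℝ) : ℂ) := by
    rw [Complex.ofReal_zero]
    exact (hG.analyticAt (Metric.ball_mem_nhds 0 one_pos)).restrictScalars
  have hof : AnalyticAt ℝ (fun s : ℝ => (s : ℂ)) 0 := Complex.ofRealCLM.analyticAt 0
  convert! han.comp_of_eq hof rfl using 1
  funext s
  simp only [Function.comp_apply, hF, machForm_add_left, machForm_smul_left]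
  push_cast
  rfl

/-- A bounded-support density is determined by its Fourier transform near the origin. -/
theorem ae_eq_zero_of_integral_exp_machForm (hm : ‖m‖ < 1) (hΩ : Bornology.IsBounded Ω)
    (hΩo : IsOpen Ω) (hq : Integrable q (volume.restrict Ω)) {τ : ℝ} (hτ : τ ≠ 0)
    (h : ∀ η, machForm m η η < 4 →
      ∫ y in Ω, Complex.exp (Complex.I * (τ * machForm m η y : ℝ)) * q y = 0) :
    q =ᵐ[volume.restrict Ω] 0 := by
  have hall : ∀ η, ∫ y in Ω, Complex.exp (Complex.I * (τ * machForm m η y : ℝ)) * q y = 0 := by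
    intro η
    refine (lineAnalyticOn_integral_exp_machForm hm hΩ hΩo hq τ).eq_zero isOpen_univ
      isPreconnected_univ (M := {η | machForm m η η < 4})
      (isOpen_lt continuous_machForm_self continuous_const) ⟨0, ?_⟩ (Set.subset_univ _) h
      (Set.mem_univ η)
    simp [machForm]
  have hae : Ω.indicator q =ᵐ[volume] 0 := by
    refine ae_eq_zero_of_forall_integral_exp_inner
      ((integrable_indicator_iff hΩo.measurableSet).2 hq) fun ξ => ?_
    obtain ⟨η, hη⟩ := exists_machForm_eq_inner hm (τ⁻¹ • ξ)
    rw [← hall η, ← integral_indicator hΩo.measurableSet]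
    congr 1
    funext y
    have e : τ * machForm m η y = inner ℝ ξ y := by
      rw [hη, real_inner_smul_left, mul_inv_cancel_left₀ hτ]
    by_cases hy : y ∈ Ω
    · rw [Set.indicator_of_mem hy, Set.indicator_of_mem hy, e]
    · rw [Set.indicator_of_notMem hy, Set.indicator_of_notMem hy, mul_zero]
  exact (indicator_ae_eq_restrict hΩo.measurableSet).symm.trans (ae_restrict_of_ae hae)

end FourierOfBounded

/-! ### Operator argument: annihilators of $\ker\mathcal G$ and the conclusion -/

theorem eq_zero_of_forall_inner_adjoint {H K : Type*} [NormedAddCommGroup H]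
    [InnerProductSpace ℂ H] [CompleteSpace H] [NormedAddCommGroup K] [InnerProductSpace ℂ K]
    [CompleteSpace K] {T : H →L[ℂ] K} {u : H}
    (h : ∀ φ : K, inner ℂ u (ContinuousLinearMap.adjoint T φ) = 0) : T u = 0 :=
  ext_inner_right ℂ fun φ => by
    rw [inner_zero_left, ← ContinuousLinearMap.adjoint_inner_right, h]

namespace AcousticSetup

variable {d : ℕ} (S : AcousticSetup d)

theorem isFiniteMeasure_restrict : IsFiniteMeasure (volume.restrict S.Ω) :=
  ⟨by
    rw [Measure.restrict_apply_univ]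
    exact S.isBounded_Ω.measure_lt_top⟩

theorem integrable_coeFn (v : Lp ℂ 2 (volume.restrict S.Ω)) :
    Integrable v (volume.restrict S.Ω) :=
  have := S.isFiniteMeasure_restrict
  (Lp.memLp v).integrable one_le_two

/-- Vanishing in $L^2(\mathbb M)$ is only a.e.; continuity makes it pointwise on the open set
$\mathbb M$, and unique continuation carries it through the connected exterior. -/
theorem potential_eq_zero_of_volumePotential_eq_zero {v : Lp ℂ 2 (volume.restrict S.Ω)}
    (hv : S.volumePotential v = 0) :
    ∀ x ∈ (closure S.Ω)ᶜ, ∫ y in S.Ω, greenKernel S.k S.m (x - y) * v y = 0 := by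
  have hvi := S.integrable_coeFn v
  have hc := continuousOn_potential S.dim_eq S.k_pos S.subsonic S.isBounded_Ω S.isOpen_Ω hvi
  have hae : (fun x => ∫ y in S.Ω, greenKernel S.k S.m (x - y) * v y) =ᵐ[volume.restrict S.M]
      fun _ => 0 := by
    have h1 := (memLp_integral_mul S.memLp_green v).coeFn_toLp
    have h2 : (memLp_integral_mul S.memLp_green v).toLp _ = 0 := hv
    rw [h2] at h1
    exact h1.symm.trans (Lp.coeFn_zero ℂ 2 _)
  have hM : Set.EqOn (fun x => ∫ y in S.Ω, greenKernel S.k S.m (x - y) * v y) (fun _ => 0) S.M :=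
    Measure.eqOn_open_of_ae_eq hae S.isOpen_M (hc.mono S.M_subset) continuousOn_const
  intro x hx
  exact (lineAnalyticOn_potential S.dim_eq S.k_pos S.subsonic S.isBounded_Ω S.isOpen_Ω hvi).eq_zero
    isClosed_closure.isOpen_compl S.isConnected_compl.isPreconnected S.isOpen_M S.nonempty_M
    S.M_subset (fun y hy => hM hy) hx

/-- The far field pattern of a point source, up to normalization and with sign `σ` of the phase. -/
def planeWave (σ : ℝ) (ω y : EuclideanSpace ℝ (Fin d)) : ℂ :=
  Complex.exp (Complex.I *
    ((S.k / betaSq S.m * (inner ℝ y S.m - σ * machForm S.m ω y) : ℝ) : ℂ))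

theorem norm_planeWave (σ : ℝ) (ω y : EuclideanSpace ℝ (Fin d)) : ‖S.planeWave σ ω y‖ = 1 := by
  rw [planeWave, mul_comm, Complex.norm_exp_ofReal_mul_I]

theorem continuous_planeWave (σ : ℝ) (ω : EuclideanSpace ℝ (Fin d)) :
    Continuous (S.planeWave σ ω) := by
  unfold planeWave machForm
  fun_prop

/-- Conjugation removes the flow phase $\kappa\,y\cdot\mathbf m$ common to both waves, leaving a
Fourier exponential with frequency proportional to $\omega-\omega'$. -/
theorem planeWave_mul_star (σ : ℝ) (ω ω' y : EuclideanSpace ℝ (Fin d)) :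
    S.planeWave σ ω y * star (S.planeWave σ ω' y) =
      Complex.exp (Complex.I * (-(S.k / betaSq S.m * σ) * machForm S.m (ω - ω') y : ℝ)) := by
  rw [planeWave, planeWave]
  simp only [RCLike.star_def, ← Complex.exp_conj, map_mul, Complex.conj_I, Complex.conj_ofReal]
  rw [← Complex.exp_add, machForm_sub_left]
  congr 1
  push_cast
  ring

theorem memLp_planeWave_mul (σ : ℝ) (ω : EuclideanSpace ℝ (Fin d))
    (q : Lp ℂ ⊤ (volume.restrict S.Ω)) :
    MemLp (fun y => S.planeWave σ ω y * q y) 2 (volume.restrict S.Ω) := by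
  have := S.isFiniteMeasure_restrict
  have hq : MemLp q 2 (volume.restrict S.Ω) := (Lp.memLp q).mono_exponent le_top
  refine hq.mono ((S.continuous_planeWave σ ω).aestronglyMeasurable.mul hq.1)
    (Eventually.of_forall fun y => ?_)
  rw [norm_mul, norm_planeWave, one_mul]

theorem coeFn_mulOperator (q : Lp ℂ ⊤ (volume.restrict S.Ω)) (ψ : Lp ℂ 2 (volume.restrict S.Ω)) :
    S.mulOperator q ψ =ᵐ[volume.restrict S.Ω] fun y => q y * ψ y :=
  ContinuousLinearMap.coeFn_holder (r := 2) (ContinuousLinearMap.mul ℂ ℂ) q ψ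

theorem integral_mul_mulOperator (q : Lp ℂ ⊤ (volume.restrict S.Ω))
    (f : EuclideanSpace ℝ (Fin d) → ℂ) (ψ : Lp ℂ 2 (volume.restrict S.Ω)) :
    ∫ y in S.Ω, f y * S.mulOperator q ψ y = ∫ y in S.Ω, f y * q y * ψ y := by
  refine integral_congr_ae ?_
  filter_upwards [S.coeFn_mulOperator q ψ] with y hy
  exact (congrArg (f y * ·) hy).trans (mul_assoc _ _ _).symm

/-- The hypothesis on $f$, applied to $M_q\mathcal G^*\varphi\in\ker\mathcal G$, puts
$\overline{fq}$ in $(\operatorname{ran}\mathcal G^*)^\perp=\ker\mathcal G$; the hypothesis on $g$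
then applies to $\overline{fq}$. -/
theorem integral_mul_star_eq_zero {q : Lp ℂ ⊤ (volume.restrict S.Ω)}
    (hq : S.volumePotential ∘L S.mulOperator q ∘L
      ContinuousLinearMap.adjoint S.volumePotential = 0) {f g : EuclideanSpace ℝ (Fin d) → ℂ}
    (hf : ∀ v : Lp ℂ 2 (volume.restrict S.Ω), S.volumePotential v = 0 →
      ∫ y in S.Ω, f y * v y = 0)
    (hg : ∀ v : Lp ℂ 2 (volume.restrict S.Ω), S.volumePotential v = 0 →
      ∫ y in S.Ω, g y * v y = 0)
    (hfq : MemLp (fun y => f y * q y) 2 (volume.restrict S.Ω)) :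
    ∫ y in S.Ω, g y * star (f y * q y) = 0 := by
  have hGu : S.volumePotential (hfq.star.toLp (star fun y => f y * q y)) = 0 := by
    refine eq_zero_of_forall_inner_adjoint fun φ => ?_
    rw [← integral_mul_eq_inner hfq]
    have hv : S.volumePotential (S.mulOperator q (ContinuousLinearMap.adjoint S.volumePotential φ))
        = 0 := DFunLike.congr_fun hq φ
    exact (S.integral_mul_mulOperator q f _).symm.trans (hf _ hv)
  rw [← hg _ hGu]
  refine integral_congr_ae ?_
  filter_upwards [hfq.star.coeFn_toLp] with y hy
  exact congrArg (g y * ·) hy.symm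

theorem eq_zero_of_conjugated_mulOperator_eq_zero {q : Lp ℂ ⊤ (volume.restrict S.Ω)}
    (hq : S.volumePotential ∘L S.mulOperator q ∘L
      ContinuousLinearMap.adjoint S.volumePotential = 0) : q = 0 := by
  have := S.isFiniteMeasure_restrict
  have hqi : Integrable q (volume.restrict S.Ω) := (Lp.memLp q).integrable le_top
  obtain ⟨σ, hσ, hfar⟩ := exists_integral_planeWave_eq_zero S.dim_eq S.k_pos S.subsonic
    S.isBounded_Ω S.isOpen_Ω
  have hplane : ∀ ω, machForm S.m ω ω = 1 → ∀ v : Lp ℂ 2 (volume.restrict S.Ω),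
      S.volumePotential v = 0 → ∫ y in S.Ω, S.planeWave σ ω y * v y = 0 := fun ω hω v hv =>
    hfar v (S.integrable_coeFn v) (S.potential_eq_zero_of_volumePotential_eq_zero hv) ω hω
  have hprod : ∀ ω ω', machForm S.m ω ω = 1 → machForm S.m ω' ω' = 1 →
      ∫ y in S.Ω, S.planeWave σ ω' y * star (S.planeWave σ ω y * q y) = 0 := fun ω ω' hω hω' =>
    S.integral_mul_star_eq_zero hq (hplane ω hω) (hplane ω' hω') (S.memLp_planeWave_mul σ ω q)
  have hκ : S.k / betaSq S.m ≠ 0 := (div_pos S.k_pos (betaSq_pos S.subsonic)).ne'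
  have hae := ae_eq_zero_of_integral_exp_machForm S.subsonic S.isBounded_Ω S.isOpen_Ω hqi
    (τ := -(S.k / betaSq S.m * σ)) (neg_ne_zero.2 (mul_ne_zero hκ hσ)) fun η hη => by
      obtain ⟨ω, ω', hω, hω', rfl⟩ := exists_sub_eq_of_machForm_le S.dim_eq S.subsonic hη.le
      -- The orthogonality relation involves $\bar q$; conjugating it yields $q$ against the
      -- exponential of $\omega-\omega'$.
      have h := congrArg star (hprod ω ω' hω hω')
      rw [star_zero, RCLike.star_def, ← integral_conj] at h
      rw [← h]
      refine integral_congr_ae (Eventually.of_forall fun y => ?_)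
      simp only [← S.planeWave_mul_star, map_mul, RCLike.star_def, Complex.conj_conj]
      ring
  exact Lp.ext (hae.trans (Lp.coeFn_zero ℂ ⊤ _).symm)

end AcousticSetup

end

theorem theorem1 (d : ℕ) (S : AcousticSetup d) (q₁ q₂ : Lp ℂ ⊤ (volume.restrict S.Ω))
    (h : S.forwardOperator q₁ = S.forwardOperator q₂) : q₁ = q₂ := by
  have hop := congrArg Subtype.val h
  refine sub_eq_zero.1 (S.eq_zero_of_conjugated_mulOperator_eq_zero ?_)
  have hsub : S.mulOperator (q₁ - q₂) = S.mulOperator q₁ - S.mulOperator q₂ :=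
    map_sub ((ContinuousLinearMap.mul ℂ ℂ).holderL (volume.restrict S.Ω) ⊤ 2 2) q₁ q₂
  rw [hsub, ContinuousLinearMap.sub_comp, ContinuousLinearMap.comp_sub]
  exact sub_eq_zero.2 hop
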